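/- **Setting.** Let $\phi=C_1\vee\dots\vee C_m$ ($m\ge 1$) be a DNF formula over $n$ Boolean variables, where each cube $C_i$ is a conjunction of $w_i$ literals on distinct variables. Let $R_\phi\subseteq\{0,1\}^n$ be its set of satisfying assignments, and let $w=\min_i w_i$ (the common width, if all cubes have the same width). Put $U'=\{(x,i): x\models C_i\}$, so $|U'|=\sum_i 2^{n-w_i}$, and $q=\lceil\log_2|U'|\rceil$ (so $q=n-w+\log_2 m$ if all widths equal $w$ and $m$ is a power of two). Fix orderings of cubes and variables. A vector $z\in\{0,1\}^q$, read as a binary number with its last bits most significant, is *interpreted* as follows: the numbers below $|U'|$ are split into consecutive blocks of lengths $2^{n-w_1},\dots,2^{n-w_m}$; the block containing the number determines $i$, and the bits of the position in the block give the values of the $n-w_i$ variables not in $C_i$, which determines $x\models C_i$. Numbers $\ge|U'|$ stand for no pair. **Algorithm $\mathsf{SymbolicDNFApproxMC}(\phi,\varepsilon,\delta)$.** Let $H=2\bigl(1+9.84(1+\frac{\varepsilon}{1+\varepsilon})(1+\frac1\varepsilon)^2\bigr)$ and $t=\lceil 17\log_2(3/\delta)\rceil$. Run the core procedure $t$ times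 independently; each run returns a pair $(2^p,s)$. Return the median $c$ of the $t$ numbers $2^p s$ (the mean of the two middle ones if $t$ is even). *Core procedure.* Let $s_I=\lfloor n-w-\log_2 H\rfloor$. Sample, over $\mathbb F_2$, a uniform $s_I\times(q-s_I)$ matrix $G$, a uniform upper triangular $(q-s_I-1)\times(q-s_I)$ matrix $E$ with ones on the diagonal, and uniform $\hat b,\hat y\in\{0,1\}^{q-1}$. Put $\hat D=\left[\begin{smallmatrix}G\\E\end{smallmatrix}\right]$. For $s_I\le p\le q-1$ the stochastic count $\mathsf{BSAT}(p)$ is obtained as follows. - Take the first $p$ rows of $\hat D,\hat b,\hat y$. For $i=s_I,\dots,p-1$ and each $j<i$ (rows and columns numbered from $0$), add row $i$ to row $j$ if row $j$ has a one in column $i-s_I$, with the same operation on $\hat b,\hat y$. This gives $b,y$, and the columns from $p-s_I$ on form $D$, a $p\times(q-p)$ matrix. The hash function is $h(z)=[I\,|\,D]z\oplus b$ and the cell is $h^{-1}(y)$. - Enumerate the vectors $z=[Dv\oplus b\oplus y : v]$ of the cell, with $v$ running through $\{0,1\}^{q-p}$ in Gray code order from $0$, and keep a count that starts at $0$. If $z$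 is interpreted as $(x,i)$, sample cubes $C_j$ independently and uniformly until $x\models C_j$ or until (count $+\,c_x/m)\ge H$, where $c_x$ is the number of cubes sampled for this $z$; then add $c_x/m$ to the count. Vectors that stand for no pair add nothing. As soon as the count is $\ge H$, stop and return $H$; otherwise return the final count. Find $p$ by binary search, with fresh cube samples for every call of $\mathsf{BSAT}$: if $\mathsf{BSAT}(s_I)<H$ then $p=s_I$; otherwise start with $\ell=s_I$, $u=q-1$, and while $u>\ell+1$ call $\mathsf{BSAT}$ at $\lfloor(\ell+u)/2\rfloor$ and replace $\ell$ by this number if the result is $\ge H$, and $u$ otherwise; then $p=u$. Call $\mathsf{BSAT}(p)$ once more to get $s$, and return $(2^p,s)$. **Theorem.** Let $\phi$ be a DNF formula as above and let $\varepsilon,\delta\in(0,1)$ be such that the initial number of hash constraints is not negative, that is, $n-w-\log_2 H\ge 0$. Then the count $c$ returned by $\mathsf{SymbolicDNFApproxMC}(\phi,\varepsilon,\delta)$ satisfies $$\Pr\Bigl[\frac{|R_\phi|}{1+\varepsilon}\le c\le(1+\varepsilon)|R_\phi|\Bigr]\ \ge\ 1-\delta .$$ -/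

import Mathlib

namespace SymbolicDNF

/-! ### DNF formulas -/

/-- A cube over `n` variables: a conjunction of literals on distinct variables, i.e. a partial
assignment. `C v = some true` if the literal `x_v` occurs, `C v = some false` if `¬ x_v` occurs and
`C v = none` if the variable `x_v` does not occur in the cube. -/
abbrev Cube (n : ℕ) : Type := Fin n → Option Bool

/-- A DNF formula with `m` cubes over `n` variables (the disjunction of the cubes). -/
abbrev DNF (n m : ℕ) : Type := Fin m → Cube n

variable {n m : ℕ}

/-- The number of literals of a cube. -/
def Cube.width (C : Cube n) : ℕ := (Finset.univ.filter fun v => C v ≠ none).card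

/-- `x ⊨ C`: every literal of the cube is true under `x`. -/
def Cube.Sat (C : Cube n) (x : Fin n → Bool) : Prop := ∀ v b, C v = some b → x v = b

/-- The set `R_φ` of satisfying assignments of a DNF formula. -/
def solutions (φ : DNF n m) : Set (Fin n → Bool) := {x | ∃ i, (φ i).Sat x}

/-- The width `w` of the cubes, if all have the same width; in general the least width. -/
noncomputable def cubeWidth (φ : DNF n m) : ℕ := ⨅ i, (φ i).width

/-! ### The symbolic universe of pairs `(x, C_i)` with `x ⊨ C_i` -/

/-- The number of pairs `(x, i)` with `x ⊨ C_i`. It is `m * 2 ^ (n - w)` if all cubes have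
width `w`. -/
def numPairs (φ : DNF n m) : ℕ := ∑ i, 2 ^ (n - (φ i).width)

/-- The number `q` of bits that address the pairs: `⌈log₂ (numPairs φ)⌉`, which is
`n - w + ⌈log₂ m⌉` if all cubes have width `w`. -/
def numBits (φ : DNF n m) : ℕ := Nat.clog 2 (numPairs φ)

/-- The assignment that agrees with the cube `C` and gives to the `k`-th variable that does not
occur in `C` the `k`-th bit of `r`. -/
def complete (C : Cube n) (r : ℕ) : Fin n → Bool := fun v =>
  (C v).getD (r.testBit (Finset.univ.filter fun u => u < v ∧ C u = none).card)

/-- A bit vector is read as a number (the last bits are the most significant ones). -/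
def bitsToNat {q : ℕ} (z : Fin q → ZMod 2) : ℕ := ∑ k, (z k).val * 2 ^ (k : ℕ)

/-- The pair `(x, i)` that a bit vector stands for. The numbers below `numPairs φ` are divided into
consecutive blocks, the `i`-th block having length `2 ^ (n - width C_i)`: the block containing the
number of `z` gives the cube, and the position in the block gives the values of the variables that
do not occur in the cube. If all cubes have width `w` and `m` is a power of two, then the last
`log₂ m` bits give the cube, the first `n - w` bits give the other variables, and this is a
bijection onto the pairs. Otherwise the numbers from `numPairs φ` on stand for no pair. -/
def interpret {q : ℕ} (φ : DNF n m) (z : Fin q → ZMod 2) : Option ((Fin n → Bool) × Fin m) :=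
  if h : bitsToNat z < numPairs φ then
    let s : (i : Fin m) × Fin (2 ^ (n - (φ i).width)) := finSigmaFinEquiv.symm ⟨bitsToNat z, h⟩
    some (complete (φ s.1) s.2, s.1)
  else none

/-! ### Row-echelon hash functions -/

/-- The randomness behind the hash functions and cells with `p` constraints, `sI ≤ p ≤ q - 1`.
The full hash matrix has the identity (then zeros) in its first `sI` columns and rows, and `D` holds
the remaining `q - sI` columns of its `q - 1` rows. -/
structure Base (q sI : ℕ) where
  /-- the base matrix -/
  D : Matrix (Fin (q - 1)) (Fin (q - sI)) (ZMod 2)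
  /-- the base offset of the hash function -/
  b : Fin (q - 1) → ZMod 2
  /-- the base cell -/
  y : Fin (q - 1) → ZMod 2

/-- The matrix with rows `G` on top of the rows of the upper triangular matrix that has ones on the
diagonal and the entries of `F` above it. -/
def baseMatrix (q sI : ℕ) (G : Matrix (Fin sI) (Fin (q - sI)) (ZMod 2))
    (F : Matrix (Fin (q - sI - 1)) (Fin (q - sI)) (ZMod 2)) :
    Matrix (Fin (q - 1)) (Fin (q - sI)) (ZMod 2) := fun i j =>
  if h : (i : ℕ) < sI then G ⟨i, h⟩ j
  else if (j : ℕ) = i - sI then 1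
  else if (j : ℕ) < i - sI then 0
  else F ⟨i - sI, by omega⟩ j

/-- SampleBase. Only the entries above the diagonal of the uniform matrix `F` are used, so the
triangular part is uniform among upper triangular matrices with ones on the diagonal. -/
noncomputable def sampleBase (q sI : ℕ) : PMF (Base q sI) := do
  let G ← PMF.uniformOfFintype (Matrix (Fin sI) (Fin (q - sI)) (ZMod 2))
  let F ← PMF.uniformOfFintype (Matrix (Fin (q - sI - 1)) (Fin (q - sI)) (ZMod 2))
  let b ← PMF.uniformOfFintype (Fin (q - 1) → ZMod 2)
  let y ← PMF.uniformOfFintype (Fin (q - 1) → ZMod 2)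
  return ⟨baseMatrix q sI G F, b, y⟩

/-- The working arrays of the elimination (zero outside of their range). -/
structure Work where
  /-- matrix -/
  D : ℕ → ℕ → ZMod 2
  /-- offset -/
  b : ℕ → ZMod 2
  /-- cell -/
  y : ℕ → ZMod 2

/-- The base arrays as working arrays. -/
def Base.toWork {q sI : ℕ} (B : Base q sI) : Work where
  D := fun i j => if h : i < q - 1 ∧ j < q - sI then B.D ⟨i, h.1⟩ ⟨j, h.2⟩ else 0
  b := fun i => if h : i < q - 1 then B.b ⟨i, h⟩ else 0
  y := fun i => if h : i < q - 1 then B.y ⟨i, h⟩ else 0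

/-- Row `i` is added to row `j` if row `j` has a one in column `i - sI`. -/
def eliminate (sI i : ℕ) (W : Work) (j : ℕ) : Work :=
  if W.D j (i - sI) = 1 then
    { D := Function.update W.D j (W.D j + W.D i)
      b := Function.update W.b j (W.b j + W.b i)
      y := Function.update W.y j (W.y j + W.y i) }
  else W

/-- A row-echelon hash function `h z = [I | D] z + b` from `q` bits to `p` bits with a cell `y`. -/
structure HashCell (q p : ℕ) where
  /-- the columns of the free variables -/
  D : Matrix (Fin p) (Fin (q - p)) (ZMod 2)
  /-- the offset of the hash function -/
  b : Fin p → ZMod 2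
  /-- the cell -/
  y : Fin p → ZMod 2

/-- Extract: the hash function and cell given by the first `p` rows, for `sI ≤ p ≤ q - 1`. The rows
`i = sI, …, p - 1` are used in this order to reduce all the rows `j < i` above them. -/
def extract {q sI : ℕ} (B : Base q sI) (p : ℕ) : HashCell q p :=
  let W := (List.range' sI (p - sI)).foldl
    (fun W i => (List.range i).foldl (eliminate sI i) W) B.toWork
  { D := fun i j => W.D i (p - sI + j)
    b := fun i => W.b i
    y := fun i => W.y i }

/-- The bit vector `[u : v]`. -/
def joinBits {q p : ℕ} (u : Fin p → ZMod 2) (v : Fin (q - p) → ZMod 2) : Fin q → ZMod 2 :=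
  fun k => if h : (k : ℕ) < p then u ⟨k, h⟩ else v ⟨k - p, by omega⟩

/-- The position of the bit in which the `j`-th and the `(j+1)`-st words of the standard (reflected)
Gray code differ: the number of trailing zeros of `j + 1`. -/
def nextGrayBit (j : ℕ) : ℕ := padicValNat 2 (j + 1)

/-- enumNextREX: bit `k` of the free part `v` is flipped and the dependent part `u` is updated.
(Nothing happens if `k` is out of range, as after the last word of the Gray code.) -/
def enumNextREX {p l : ℕ} (D : Matrix (Fin p) (Fin l) (ZMod 2))
    (uv : (Fin p → ZMod 2) × (Fin l → ZMod 2)) (k : ℕ) : (Fin p → ZMod 2) × (Fin l → ZMod 2) :=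
  if h : k < l then
    (fun i => uv.1 i + D i ⟨k, h⟩, Function.update uv.2 ⟨k, h⟩ (uv.2 ⟨k, h⟩ + 1))
  else uv

/-! ### Stochastic cell counting -/

variable [NeZero m]

open Classical in
/-- The loop of CheckSAT, where `c` cubes have been sampled so far and at most `fuel` more are
allowed. -/
noncomputable def checkSATLoop (φ : DNF n m) (x : Fin n → Bool) (count hiThresh : ℝ) :
    (fuel c : ℕ) → PMF ℝ
  | 0, c => pure ((c : ℝ) / m)
  | fuel + 1, c =>
    if count + (c : ℝ) / m < hiThresh then do
      let j ← PMF.uniformOfFintype (Fin m)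
      if (φ j).Sat x then
        return (((c + 1 : ℕ) : ℝ) / m)
      else
        checkSATLoop φ x count hiThresh fuel (c + 1)
    else pure ((c : ℝ) / m)

/-- CheckSAT: cubes are sampled uniformly until one of them is satisfied by `x` or `hiThresh` is
reached. The loop makes at most `⌈m * hiThresh⌉` rounds (as `0 ≤ count`), so that the bound on the
number of rounds never interferes. -/
noncomputable def checkSAT (φ : DNF n m) (x : Fin n → Bool) (count hiThresh : ℝ) : PMF ℝ :=
  checkSATLoop φ x count hiThresh ⌈m * hiThresh⌉₊ 0

/-- The loop of BSAT with `todo` rounds left, the current round being number `j`. Bit vectors that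
stand for no pair contribute nothing. -/
noncomputable def bsatLoop {q p : ℕ} (φ : DNF n m) (hiThresh : ℝ)
    (D : Matrix (Fin p) (Fin (q - p)) (ZMod 2)) :
    (todo j : ℕ) → (count : ℝ) → (Fin p → ZMod 2) × (Fin (q - p) → ZMod 2) → PMF ℝ
  | 0, _, count, _ => pure count
  | todo + 1, j, count, uv => do
    let c ← match interpret φ (joinBits uv.1 uv.2) with
      | some (x, _) => checkSAT φ x count hiThresh
      | none => pure 0
    if hiThresh ≤ count + c then
      return hiThresh
    else
      bsatLoop φ hiThresh D todo (j + 1) (count + c) (enumNextREX D uv (nextGrayBit j))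

/-- BSAT: the stochastic count of the cell with `p` constraints, cut off at `hiThresh`. -/
noncomputable def bsat {q sI : ℕ} (φ : DNF n m) (B : Base q sI) (hiThresh : ℝ) (p : ℕ) : PMF ℝ :=
  let H := extract B p
  bsatLoop φ hiThresh H.D (2 ^ (q - p)) 0 0 (H.b + H.y, 0)

/-! ### The search and the full algorithm -/

/-- Binary search between a number `lower` of constraints recorded as failing (count at least
`hiThresh`) and a number `upper` recorded as succeeding, until they are adjacent. -/
noncomputable def searchLoop {q sI : ℕ} (φ : DNF n m) (B : Base q sI) (hiThresh : ℝ)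
    (lower upper : ℕ) : PMF ℕ :=
  if upper ≤ lower + 1 then pure upper
  else do
    let c ← bsat φ B hiThresh ((lower + upper) / 2)
    if hiThresh ≤ c then searchLoop φ B hiThresh ((lower + upper) / 2) upper
    else searchLoop φ B hiThresh lower ((lower + upper) / 2)
termination_by upper - lower
decreasing_by all_goals omega

/-- LogSATSearch: `low` is tested first; `hi` is recorded as succeeding without a test. -/
noncomputable def logSATSearch {q sI : ℕ} (φ : DNF n m) (B : Base q sI) (hiThresh : ℝ)
    (low hi : ℕ) : PMF ℕ := do
  let c ← bsat φ B hiThresh low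
  if hiThresh ≤ c then searchLoop φ B hiThresh low hi else return low

/-- The number `n - w - log₂ hiThresh` whose integer part is the initial number of constraints. -/
noncomputable def startIndex (φ : DNF n m) (hiThresh : ℝ) : ℝ :=
  (n : ℝ) - cubeWidth φ - Real.logb 2 hiThresh

/-- SymbolicDNFApproxMCCore: returns the number of cells and the stochastic count of one cell. -/
noncomputable def symbolicDNFApproxMCCore (φ : DNF n m) (hiThresh : ℝ) : PMF (ℕ × ℝ) := do
  let q := numBits φ
  let sI := ⌊startIndex φ hiThresh⌋₊
  let B ← sampleBase q sI
  let p ← logSATSearch φ B hiThresh sI (q - 1)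
  let solCount ← bsat φ B hiThresh p
  return (2 ^ p, solCount)

/-- The threshold for the cell counts. -/
noncomputable def hiThresh (ε : ℝ) : ℝ :=
  2 * (1 + 9.84 * (1 + ε / (1 + ε)) * (1 + 1 / ε) ^ 2)

/-- The median of a list: the middle entry of the sorted list, or the mean of the two middle entries
if the length is even. -/
noncomputable def median (l : List ℝ) : ℝ :=
  let s := l.insertionSort (· ≤ ·)
  (s.getD ((s.length - 1) / 2) 0 + s.getD (s.length / 2) 0) / 2

/-- The list of the estimates of `t` independent runs of the core algorithm. -/
noncomputable def estimateList (φ : DNF n m) (hiThresh : ℝ) : (t : ℕ) → PMF (List ℝ)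
  | 0 => pure []
  | t + 1 => do
    let l ← estimateList φ hiThresh t
    let (cellCount, solCount) ← symbolicDNFApproxMCCore φ hiThresh
    return (l ++ [solCount * cellCount])

/-- SymbolicDNFApproxMC, as the distribution of the count that it returns. -/
noncomputable def symbolicDNFApproxMC (φ : DNF n m) (ε δ : ℝ) : PMF ℝ := do
  let l ← estimateList φ (hiThresh ε) ⌈17 * Real.logb 2 (3 / δ)⌉₊
  return median l

end SymbolicDNF

/-! Fix a number `p` of constraints. A vector standing for `(x, i)` contributes a geometric waiting
time divided by `m`; if `x` satisfies `d` cubes, its mean is `1/d` and its variance is at most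
`1/d²`. Since exactly `d` vectors stand for each solution `x`, all means add up to `|R_φ|`
(`sum_weight`). Row operations preserve the cell, the Gray code visits each of its vectors once, and
a random cell contains a given vector with probability `2^(-p)` and two given vectors with
probability at most `4^(-p)`. Hence the uncut count has mean `μ = |R_φ| / 2^p` and second moment
about any `s` at most `(μ - s)² + 2μ`. The cutoff at `H` does no harm, because only events are
considered for which a count that overruns `H` stays on the same side of `s`. This is
`expect_prob_bsat_le`; it yields Chebyshev bounds and, with a shifted centre `s`, Cantelli bounds.

Put `κ = ε/(1+ε)` and `a = 9.84/κ²`, so that `H = 2 + (2+2κ)a`. The critical number `p₀` is the one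
with `a ≤ μ < 2a`; it lies strictly inside the range of the search. A run fails only if some test
above `p₀` reports a large count, or the test or the final count at `p₀` goes wrong, or for some `k
< p₀` both the test at `k` reports a small count and the final count at `k` is inaccurate
(`prob_core_le`). These errors decay geometrically on both sides of `p₀`. Numerical bounds,
separated at `κ = 0.29`, give a total of at most `0.36`. As `0.36 < 1/2`, an exponential moment
bound for the number of bad runs controls the median (`approxMC_of_core`). -/

namespace SymbolicDNF

open scoped ENNReal

/-! ### Expectations under probability mass functions -/

/-- The expectation of a nonnegative function. -/
noncomputable def expect {α : Type} (p : PMF α) (f : α → ℝ≥0∞) : ℝ≥0∞ := ∑' a, p a * f a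

/-- The probability of a set. -/
noncomputable def prob {α : Type} (p : PMF α) (S : Set α) : ℝ≥0∞ := expect p (S.indicator 1)

theorem expect_pure {α : Type} (a : α) (f : α → ℝ≥0∞) : expect (pure a) f = f a := by
  unfold expect
  rw [tsum_eq_single a]
  · change (PMF.pure a) a * f a = f a
    simp
  · intro b hb
    change (PMF.pure a) b * f b = 0
    simp [PMF.pure_apply, hb]

theorem expect_bind {α β : Type} (p : PMF α) (g : α → PMF β) (f : β → ℝ≥0∞) :
    expect (p >>= g) f = expect p fun a => expect (g a) f := by
  unfold expect
  change ∑' b, (p.bind g) b * f b = _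
  simp_rw [PMF.bind_apply, ← ENNReal.tsum_mul_right]
  rw [ENNReal.tsum_comm]
  simp_rw [← ENNReal.tsum_mul_left, mul_assoc]

theorem expect_mono {α : Type} (p : PMF α) {f g : α → ℝ≥0∞} (h : ∀ a, f a ≤ g a) :
    expect p f ≤ expect p g :=
  ENNReal.tsum_le_tsum fun a => mul_le_mul_right (h a) _

theorem expect_const {α : Type} (p : PMF α) (c : ℝ≥0∞) : (expect p fun _ => c) = c := by
  unfold expect
  rw [ENNReal.tsum_mul_right, p.tsum_coe, one_mul]

theorem expect_add {α : Type} (p : PMF α) (f g : α → ℝ≥0∞) :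
    (expect p fun a => f a + g a) = expect p f + expect p g := by
  unfold expect
  simp_rw [mul_add]
  exact ENNReal.tsum_add

theorem expect_mul_right {α : Type} (p : PMF α) (f : α → ℝ≥0∞) (c : ℝ≥0∞) :
    (expect p fun a => f a * c) = expect p f * c := by
  unfold expect
  simp_rw [← mul_assoc]
  exact ENNReal.tsum_mul_right

theorem expect_finset_sum {α ι : Type} (p : PMF α) (s : Finset ι) (f : ι → α → ℝ≥0∞) :
    (expect p fun a => ∑ i ∈ s, f i a) = ∑ i ∈ s, expect p (f i) := by
  classical
  induction s using Finset.induction_on with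
  | empty => simp [expect]
  | insert i s hi ih =>
    simp_rw [Finset.sum_insert hi]
    rw [expect_add, ih]

theorem expect_le_one {α : Type} (p : PMF α) {f : α → ℝ≥0∞} (h : ∀ a, f a ≤ 1) :
    expect p f ≤ 1 :=
  (expect_mono p h).trans_eq (expect_const p 1)

theorem expect_uniform {α : Type} [Fintype α] [Nonempty α] (f : α → ℝ≥0∞) :
    expect (PMF.uniformOfFintype α) f = (Fintype.card α : ℝ≥0∞)⁻¹ * ∑ a, f a := by
  unfold expect
  simp [PMF.uniformOfFintype_apply, tsum_fintype, Finset.mul_sum]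

theorem indicator_one_le_one {α : Type} (S : Set α) (a : α) :
    S.indicator (1 : α → ℝ≥0∞) a ≤ 1 := by
  classical
  by_cases h : a ∈ S <;> simp [h]

theorem prob_le_one {α : Type} (p : PMF α) (S : Set α) : prob p S ≤ 1 :=
  expect_le_one p (indicator_one_le_one S)

theorem expect_ite_le (p : PMF ℝ) (H : ℝ) (a b : ℝ≥0∞) :
    (expect p fun c => if H ≤ c then a else b) =
      prob p (Set.Ici H) * a + prob p (Set.Iio H) * b := by
  unfold prob
  rw [← expect_mul_right, ← expect_mul_right, ← expect_add]
  congr 1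
  funext c
  by_cases h : H ≤ c
  · simp [h, not_lt.2 h]
  · simp [h, not_le.1 h]

theorem toMeasure_eq_prob (p : PMF ℝ) {S : Set ℝ} (hS : MeasurableSet S) :
    p.toMeasure S = prob p S := by
  classical
  rw [PMF.toMeasure_apply p hS]
  unfold prob expect
  congr 1
  funext a
  by_cases h : a ∈ S <;> simp [h]

/-! ### The median of independent runs -/

theorem countP_le_of_sorted {l : List ℝ} (P : ℝ → Prop) [DecidablePred P] (a b : ℕ)
    (hb : b ≤ l.length) (hP : ∀ i (hi : i < l.length), a ≤ i → i < b → P l[i]) :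
    b - a ≤ l.countP (fun x => P x) := by
  have hsub : ((l.take b).drop a).Sublist l := (List.drop_sublist _ _).trans (List.take_sublist _ _)
  refine le_trans (le_of_eq ?_) (hsub.countP_le)
  have : ∀ x ∈ (l.take b).drop a, P x := by
    intro x hx
    obtain ⟨i, hi, rfl⟩ := List.getElem_of_mem hx
    simp only [List.length_drop, List.length_take] at hi
    rw [List.getElem_drop, List.getElem_take]
    exact hP _ _ (by omega) (by omega)
  rw [List.countP_eq_length.2 (by simpa using this)]
  simp [hb]

/-- A median below `lo` forces the lower middle entry, and with it every earlier entry of the sorted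
list, below `lo`; a median above `hi` is symmetric with the upper middle entry. Either way at least
half of the entries are bad, also for even length. -/
theorem median_outside {l : List ℝ} {lo hi : ℝ} (hl : l ≠ [])
    (h : ¬(lo ≤ median l ∧ median l ≤ hi)) :
    l.length ≤ 2 * l.countP (fun x => ¬(lo ≤ x ∧ x ≤ hi)) := by
  classical
  set s := l.insertionSort (· ≤ ·) with hs
  have hperm : s.Perm l := List.perm_insertionSort _ _
  have hlen : s.length = l.length := hperm.length_eq
  have hpos : 0 < s.length := by rw [hlen]; exact List.length_pos_iff.2 hl
  have hsort : ∀ i j (hi : i < s.length) (hj : j < s.length), i ≤ j → s[i] ≤ s[j] := by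
    intro i j hi hj hij
    have := List.pairwise_insertionSort (· ≤ ·) l
    rcases hij.eq_or_lt with rfl | hlt
    · exact le_rfl
    · exact List.pairwise_iff_getElem.1 this i j hi hj hlt
  rw [← hperm.countP_eq, ← hlen]
  have h1 : (s.length - 1) / 2 < s.length := by omega
  have h2 : s.length / 2 < s.length := by omega
  have hm : median l = (s[(s.length - 1) / 2] + s[s.length / 2]) / 2 := by
    unfold median
    simp only [← hs]
    rw [List.getD_eq_getElem _ _ h1, List.getD_eq_getElem _ _ h2]
  have h12 := hsort _ _ h1 h2 (by omega)
  rw [hm, not_and_or, not_le, not_le] at h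
  rcases h with h | h
  · have := countP_le_of_sorted (l := s) (fun x => ¬(lo ≤ x ∧ x ≤ hi)) 0
      ((s.length - 1) / 2 + 1) (by omega) (by
        intro i hi _ hi' hc
        have := hsort i _ hi h1 (by omega)
        linarith [hc.1])
    omega
  · have := countP_le_of_sorted (l := s) (fun x => ¬(lo ≤ x ∧ x ≤ hi)) (s.length / 2)
      s.length le_rfl (by
        intro i hi' hi'' _ hc
        have := hsort _ i h2 hi' hi''
        linarith [hc.2])
    omega

open Classical in
/-- The weight of a list in the exponential moment bound: a factor `4 / 3` for each entry in `S`
and `3 / 4` for each other entry. -/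
noncomputable def listWeight (S : Set ℝ) (l : List ℝ) : ℝ≥0∞ :=
  (l.map fun x => if x ∈ S then ENNReal.ofReal (4 / 3) else ENNReal.ofReal (3 / 4)).prod

open Classical in
theorem listWeight_eq (S : Set ℝ) (l : List ℝ) :
    listWeight S l = ENNReal.ofReal
      ((4 / 3) ^ l.countP (fun x => x ∈ S) * (3 / 4) ^ (l.length - l.countP (fun x => x ∈ S))) := by
  unfold listWeight
  induction l with
  | nil => simp
  | cons x l ih =>
    rw [List.map_cons, List.prod_cons, ih, List.length_cons]
    have hle : l.countP (fun x => x ∈ S) ≤ l.length := List.countP_le_length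
    by_cases hx : x ∈ S
    · rw [List.countP_cons_of_pos (by simpa using hx), if_pos hx, ← ENNReal.ofReal_mul (by norm_num)]
      congr 1
      rw [show l.length + 1 - (l.countP (fun x => x ∈ S) + 1)
        = l.length - l.countP (fun x => x ∈ S) by omega, pow_succ]
      ring
    · rw [List.countP_cons_of_neg (by simpa using hx), if_neg hx, ← ENNReal.ofReal_mul (by norm_num)]
      congr 1
      rw [show l.length + 1 - l.countP (fun x => x ∈ S)
        = (l.length - l.countP (fun x => x ∈ S)) + 1 by omega, pow_succ]
      ring

/-- Because `4/3 * 3/4 = 1`, the weight is `4/3` to the power of the excess of bad over good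
entries, which is nonnegative when the median is bad. -/
theorem indicator_median_le (lo hi : ℝ) (l : List ℝ) :
    (Set.Icc lo hi)ᶜ.indicator 1 (median l) ≤ listWeight (Set.Icc lo hi)ᶜ l := by
  classical
  by_cases h : lo ≤ median l ∧ median l ≤ hi
  · rw [Set.indicator_of_notMem]
    · exact zero_le
    · simpa using h
  · rw [Set.indicator_of_mem (by simpa using h), listWeight_eq, Pi.one_apply]
    rw [← ENNReal.ofReal_one]
    apply ENNReal.ofReal_le_ofReal
    generalize hk : l.countP _ = k
    have hc : l.length ≤ 2 * k := by
      rw [← hk]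
      by_cases hl : l = []
      · simp [hl]
      · have := median_outside hl h
        convert this using 3
        simp
    obtain ⟨d, hd⟩ : ∃ d, k = (l.length - k) + d := ⟨k - (l.length - k), by omega⟩
    have : ((4 : ℝ) / 3) ^ k * (3 / 4) ^ (l.length - k) = (4 / 3) ^ d := by
      nth_rewrite 1 [hd]
      rw [pow_add, mul_right_comm, ← mul_pow]
      norm_num
    rw [this]
    exact one_le_pow₀ (by norm_num)

variable {n m : ℕ} [NeZero m]

/-- By independence the expected weight is a product over the runs. One run contributes at most `3/4
+ (4/3 - 3/4) g`, which equals `0.96` at `g = 0.36`. -/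
theorem expect_listWeight_estimateList (φ : DNF n m) (H : ℝ) (S : Set ℝ) (g : ℝ)
    (hg0 : 0 ≤ g) (hg1 : g ≤ 0.36)
    (hcore : prob (symbolicDNFApproxMCCore φ H) {r | r.2 * r.1 ∈ S} ≤ ENNReal.ofReal g) (t : ℕ) :
    expect (estimateList φ H t) (listWeight S) ≤ ENNReal.ofReal (0.96 ^ t) := by
  classical
  induction t with
  | zero =>
    rw [estimateList, expect_pure]
    simp [listWeight]
  | succ t ih =>
    have hcore' : (expect (symbolicDNFApproxMCCore φ H) fun r =>
        if r.2 * r.1 ∈ S then ENNReal.ofReal (4 / 3) else ENNReal.ofReal (3 / 4))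
        ≤ ENNReal.ofReal 0.96 := by
      have h1 : ∀ r : ℕ × ℝ, (if r.2 * r.1 ∈ S then ENNReal.ofReal (4 / 3)
          else ENNReal.ofReal (3 / 4)) =
          ({r : ℕ × ℝ | r.2 * r.1 ∈ S}.indicator 1 r) * ENNReal.ofReal (7 / 12)
            + ENNReal.ofReal (3 / 4) := by
        intro r
        by_cases h : r.2 * r.1 ∈ S
        · simp only [h, if_true, Set.mem_ofPred_eq, Set.indicator_of_mem, Pi.one_apply, one_mul]
          rw [← ENNReal.ofReal_add (by norm_num) (by norm_num)]
          norm_num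
        · simp [h]
      simp_rw [h1]
      rw [expect_add, expect_mul_right, expect_const]
      calc _ ≤ ENNReal.ofReal g * ENNReal.ofReal (7 / 12) + ENNReal.ofReal (3 / 4) := by
            gcongr
            exact hcore
        _ = ENNReal.ofReal (g * (7 / 12) + 3 / 4) := by
            rw [← ENNReal.ofReal_mul hg0, ← ENNReal.ofReal_add (by positivity) (by norm_num)]
        _ ≤ _ := ENNReal.ofReal_le_ofReal (by linarith)
    rw [estimateList, expect_bind]
    calc _ = expect (estimateList φ H t) (fun l => listWeight S l *
          expect (symbolicDNFApproxMCCore φ H) fun r =>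
          if r.2 * r.1 ∈ S then ENNReal.ofReal (4 / 3) else ENNReal.ofReal (3 / 4)) := by
          congr 1
          funext l
          rw [expect_bind, mul_comm, ← expect_mul_right]
          congr 1
          funext r
          obtain ⟨a, b⟩ := r
          simp only [expect_pure, listWeight, List.map_append, List.prod_append, List.map_cons,
            List.map_nil, List.prod_cons, List.prod_nil, mul_one]
          rw [mul_comm]
      _ ≤ _ := by
          rw [expect_mul_right, pow_succ, ENNReal.ofReal_mul (by positivity)]
          exact mul_le_mul' ih hcore'

theorem pow_rounds_le {δ : ℝ} (hδ : 0 < δ) (hδ1 : δ < 1) :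
    (0.96 : ℝ) ^ ⌈17 * Real.logb 2 (3 / δ)⌉₊ ≤ δ := by
  have hL : 0 < Real.logb 2 (3 / δ) :=
    Real.logb_pos (by norm_num) (by rw [lt_div_iff₀ hδ]; linarith)
  calc (0.96 : ℝ) ^ ⌈17 * Real.logb 2 (3 / δ)⌉₊
      = (0.96 : ℝ) ^ ((⌈17 * Real.logb 2 (3 / δ)⌉₊ : ℕ) : ℝ) := (Real.rpow_natCast _ _).symm
    _ ≤ (0.96 : ℝ) ^ (17 * Real.logb 2 (3 / δ)) :=
        Real.rpow_le_rpow_of_exponent_ge (by norm_num) (by norm_num) (Nat.le_ceil _)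
    _ = ((0.96 : ℝ) ^ (17 : ℕ)) ^ (Real.logb 2 (3 / δ)) := by
        rw [Real.rpow_mul (by norm_num), ← Real.rpow_natCast]; norm_num
    -- The number of rounds has the factor 17 because `0.96 ^ 17 ≤ 1/2`.
    _ ≤ (2⁻¹ : ℝ) ^ (Real.logb 2 (3 / δ)) :=
        Real.rpow_le_rpow (by norm_num) (by norm_num) hL.le
    _ = δ / 3 := by
        rw [Real.inv_rpow (by norm_num), Real.rpow_logb (by norm_num) (by norm_num) (by positivity)]
        rw [inv_div]
    _ ≤ δ := by linarith

theorem approxMC_of_core (φ : DNF n m) (ε δ lo hi : ℝ) (hδ : 0 < δ) (hδ1 : δ < 1)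
    (hcore : prob (symbolicDNFApproxMCCore φ (hiThresh ε)) {r | r.2 * r.1 ∈ (Set.Icc lo hi)ᶜ}
      ≤ ENNReal.ofReal 0.36) :
    1 - δ ≤ ((symbolicDNFApproxMC φ ε δ).toMeasure (Set.Icc lo hi)).toReal := by
  have hbad : (symbolicDNFApproxMC φ ε δ).toMeasure (Set.Icc lo hi)ᶜ ≤ ENNReal.ofReal δ := by
    rw [toMeasure_eq_prob _ measurableSet_Icc.compl, prob, symbolicDNFApproxMC, expect_bind]
    simp_rw [expect_pure]
    refine (expect_mono _ fun l => indicator_median_le lo hi l).trans ?_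
    refine (expect_listWeight_estimateList φ _ _ 0.36 (by norm_num) le_rfl hcore _).trans ?_
    exact ENNReal.ofReal_le_ofReal (pow_rounds_le hδ hδ1)
  have := MeasureTheory.prob_add_prob_compl (μ := (symbolicDNFApproxMC φ ε δ).toMeasure)
    (measurableSet_Icc (a := lo) (b := hi))
  have hr := congrArg ENNReal.toReal this
  rw [ENNReal.toReal_add (MeasureTheory.measure_ne_top _ _) (MeasureTheory.measure_ne_top _ _),
    ENNReal.toReal_one] at hr
  have := ENNReal.toReal_mono ENNReal.ofReal_ne_top hbad
  rw [ENNReal.toReal_ofReal hδ.le] at this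
  linarith

/-! ### The search for the number of constraints -/

/-- The contribution of the test at `k` to the failure probability of the search, where `p₀` is
the critical number of constraints: below `p₀` the test should report a large count, from `p₀` on
a small one. -/
noncomputable def stepError {q sI : ℕ} (φ : DNF n m) (B : Base q sI) (H : ℝ) (f : ℕ → ℝ≥0∞)
    (p₀ k : ℕ) : ℝ≥0∞ :=
  if k < p₀ then prob (bsat φ B H k) (Set.Iio H) * f k
  else if k = p₀ then prob (bsat φ B H k) (Set.Ici H) + f k
  else prob (bsat φ B H k) (Set.Ici H)

/-- Each `k` is charged once, although the search visits only some of them. The last summand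
accounts for the bracket: it is already lost if `p₀ ≤ l`, it may return `u` without further tests if
`u ≤ p₀`, and it is free of charge while `l < p₀ < u`. -/
theorem expect_searchLoop_le {q sI : ℕ} (φ : DNF n m) (B : Base q sI) (H : ℝ) (f : ℕ → ℝ≥0∞)
    (hf : ∀ k, f k ≤ 1) (p₀ l u : ℕ) (hlu : l < u) :
    expect (searchLoop φ B H l u) f ≤ ∑ k ∈ Finset.Ioo l u, stepError φ B H f p₀ k +
      (if p₀ ≤ l then 1 else if u ≤ p₀ then f u else 0) := by
  induction l, u using searchLoop.induct with
  | case1 l u h =>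
    rw [searchLoop, if_pos h, expect_pure]
    obtain rfl : u = l + 1 := by omega
    refine le_trans ?_ le_add_self
    by_cases hl : p₀ ≤ l
    · simpa [hl] using hf _
    · rw [if_neg hl, if_pos (by omega)]
  | case2 l u h ih1 ih2 =>
    by_cases hl : p₀ ≤ l
    · rw [if_pos hl]
      exact (expect_le_one _ hf).trans le_add_self
    rw [searchLoop, if_neg h, expect_bind]
    set k := (l + u) / 2
    have hlk : l < k := by omega
    have hku : k < u := by omega
    have ih1 := ih1 hku
    have ih2 := ih2 hlk
    rw [if_neg hl] at ih2 ⊢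
    have hsplit : ∑ i ∈ Finset.Ioo l u, stepError φ B H f p₀ i =
        ∑ i ∈ Finset.Ioo l k, stepError φ B H f p₀ i + stepError φ B H f p₀ k +
          ∑ i ∈ Finset.Ioo k u, stepError φ B H f p₀ i := by
      have : Finset.Ioo l u = insert k (Finset.Ioo l k ∪ Finset.Ioo k u) := by
        ext i; simp only [Finset.mem_Ioo, Finset.mem_insert, Finset.mem_union]; omega
      rw [this, Finset.sum_insert (by simp), Finset.sum_union]
      · ring
      · rw [Finset.disjoint_left]; intro i; simp only [Finset.mem_Ioo]; omega
    have hif : ∀ c : ℝ, expect (if H ≤ c then searchLoop φ B H k u else searchLoop φ B H l k) f =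
        if H ≤ c then expect (searchLoop φ B H k u) f else expect (searchLoop φ B H l k) f := by
      intro c; split_ifs <;> rfl
    simp_rw [hif]
    rw [expect_ite_le, hsplit]
    set hiP := prob (bsat φ B H k) (Set.Ici H) with hhi
    set loP := prob (bsat φ B H k) (Set.Iio H) with hlo
    have hhi1 : hiP ≤ 1 := prob_le_one _ _
    have hlo1 : loP ≤ 1 := prob_le_one _ _
    rcases lt_or_ge k p₀ with hk | hk
    -- Below `p₀` a wrong (small) result makes `k` the new upper end. Then either `k` is returned,
    -- at cost `f k`, or a still smaller number is, which is charged to a test below `k`. This is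
    -- why the test error at `k` enters only multiplied by `f k`.
    · rw [if_neg (by omega)] at ih1
      rw [if_pos hk.le] at ih2
      have hs : stepError φ B H f p₀ k = loP * f k := by rw [stepError, if_pos hk]
      rw [hs]
      calc _ ≤ hiP * _ + loP * _ := add_le_add (mul_le_mul_right ih1 _) (mul_le_mul_right ih2 _)
        _ ≤ 1 * (∑ k ∈ Finset.Ioo k u, stepError φ B H f p₀ k + if u ≤ p₀ then f u else 0)
          + (1 * ∑ k ∈ Finset.Ioo l k, stepError φ B H f p₀ k + loP * f k) := by
            rw [mul_add loP]
            gcongr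
        _ = _ := by ring
    -- From `p₀` on a large result counts as a full failure; after a small one the new upper end
    -- costs `f k` only when `k = p₀`.
    · rw [if_neg ((hk.trans_lt hku).not_ge), add_zero]
      have hs : hiP + (if k ≤ p₀ then f k else 0) ≤ stepError φ B H f p₀ k := by
        rw [stepError, if_neg hk.not_gt]
        rcases hk.eq_or_lt with hkp | hkp
        · rw [if_pos hkp.symm, if_pos hkp.ge]
        · rw [if_neg hkp.ne', if_neg hkp.not_ge, add_zero]
      calc _ ≤ hiP * 1 + 1 * _ :=
            add_le_add (mul_le_mul_right (expect_le_one _ hf) _) (mul_le_mul' hlo1 ih2)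
        _ = ∑ k ∈ Finset.Ioo l k, stepError φ B H f p₀ k +
            (hiP + if k ≤ p₀ then f k else 0) := by ring
        _ ≤ ∑ k ∈ Finset.Ioo l k, stepError φ B H f p₀ k + stepError φ B H f p₀ k := by gcongr
        _ ≤ _ := le_self_add

theorem expect_logSATSearch_le {q sI : ℕ} (φ : DNF n m) (B : Base q sI) (H : ℝ) (f : ℕ → ℝ≥0∞)
    (hf : ∀ k, f k ≤ 1) (p₀ l u : ℕ) (hl : l < p₀) (hu : p₀ < u) :
    expect (logSATSearch φ B H l u) f ≤ ∑ k ∈ Finset.Ico l u, stepError φ B H f p₀ k := by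
  rw [logSATSearch, expect_bind]
  have hif : ∀ c : ℝ, expect (if H ≤ c then searchLoop φ B H l u else pure l) f =
      if H ≤ c then expect (searchLoop φ B H l u) f else f l := by
    intro c; split_ifs <;> simp [expect_pure]
  simp_rw [hif]
  rw [expect_ite_le]
  have h1 := expect_searchLoop_le φ B H f hf p₀ l u (hl.trans hu)
  rw [if_neg (by omega), if_neg (by omega), add_zero] at h1
  have hs : stepError φ B H f p₀ l = prob (bsat φ B H l) (Set.Iio H) * f l := by
    rw [stepError, if_pos hl]
  calc _ ≤ 1 * ∑ k ∈ Finset.Ioo l u, stepError φ B H f p₀ k + stepError φ B H f p₀ l := by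
        rw [hs]
        exact add_le_add (mul_le_mul' (prob_le_one _ _) h1) le_rfl
    _ = ∑ k ∈ insert l (Finset.Ioo l u), stepError φ B H f p₀ k := by
        rw [Finset.sum_insert (by simp), one_mul, add_comm]
    _ = _ := by
        congr 1
        ext i
        simp only [Finset.mem_insert, Finset.mem_Ioo, Finset.mem_Ico]
        omega

/-- The failure probability of the core algorithm is at most the sum of the contributions of all
the numbers of constraints. -/
theorem prob_core_le (φ : DNF n m) (H : ℝ) (S : Set ℝ) (p₀ : ℕ)
    (hl : ⌊startIndex φ H⌋₊ < p₀) (hu : p₀ < numBits φ - 1) :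
    prob (symbolicDNFApproxMCCore φ H) {r | r.2 * r.1 ∈ S} ≤
      ∑ k ∈ Finset.Ico ⌊startIndex φ H⌋₊ (numBits φ - 1),
        expect (sampleBase (numBits φ) ⌊startIndex φ H⌋₊) fun B =>
          stepError φ B H (fun p => prob (bsat φ B H p) {y | y * (2 : ℝ) ^ p ∈ S}) p₀ k := by
  rw [← expect_finset_sum, prob, symbolicDNFApproxMCCore, expect_bind]
  refine expect_mono _ fun B => ?_
  rw [expect_bind]
  -- Given the base `B`, the final count uses fresh cube samples, so the search is analysed with the
  -- cost function that sends `p` to the failure probability of the final count at `p`.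
  refine le_trans (le_of_eq ?_) (expect_logSATSearch_le φ B H _ (fun k => prob_le_one _ _) p₀ _ _ hl hu)
  congr 1
  funext p
  rw [expect_bind, prob]
  congr 1
  funext y
  rw [expect_pure]
  have hc : (((2 ^ p : ℕ) : ℕ) : ℝ) = (2 : ℝ) ^ p := by norm_num
  by_cases h : y * (2 : ℝ) ^ p ∈ S
  · rw [Set.indicator_of_mem (by rw [Set.mem_ofPred_eq, hc]; exact h), Set.indicator_of_mem (show y ∈ {y | y * (2 : ℝ) ^ p ∈ S} from h)]
    rfl
  · rw [Set.indicator_of_notMem (by rw [Set.mem_ofPred_eq, hc]; exact h),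
      Set.indicator_of_notMem (show y ∉ {y | y * (2 : ℝ) ^ p ∈ S} from h)]

end SymbolicDNF

namespace SymbolicDNF

open scoped ENNReal

variable {n m : ℕ}

/-! ### Moments of the stochastic count of a fixed cell -/

open Classical in
/-- The number of cubes satisfied by `x`. -/
noncomputable def degree (φ : DNF n m) (x : Fin n → Bool) : ℕ :=
  (Finset.univ.filter fun j => (φ j).Sat x).card

/-- The expected contribution of a bit vector to the count. -/
noncomputable def weight {q : ℕ} (φ : DNF n m) (z : Fin q → ZMod 2) : ℝ :=
  match interpret φ z with
  | some (x, _) => 1 / (degree φ x : ℝ)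
  | none => 0

/-- The variance of the contribution of a bit vector to the count. -/
noncomputable def weightVar {q : ℕ} (φ : DNF n m) (z : Fin q → ZMod 2) : ℝ :=
  match interpret φ z with
  | some (x, _) => (1 - (degree φ x : ℝ) / m) / (degree φ x : ℝ) ^ 2
  | none => 0

theorem degree_le (φ : DNF n m) (x : Fin n → Bool) : degree φ x ≤ m := by
  classical
  exact (Finset.card_filter_le _ _).trans_eq (by simp)

theorem complete_sat (C : Cube n) (r : ℕ) : C.Sat (complete C r) := by
  intro v b h
  simp [complete, h]

theorem sat_of_interpret {q : ℕ} {φ : DNF n m} {z : Fin q → ZMod 2} {x : Fin n → Bool} {i : Fin m}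
    (h : interpret φ z = some (x, i)) : (φ i).Sat x := by
  unfold interpret at h
  split_ifs at h with hz
  simp only [Option.some.injEq, Prod.mk.injEq] at h
  obtain ⟨rfl, rfl⟩ := h
  exact complete_sat _ _

theorem degree_pos {φ : DNF n m} {x : Fin n → Bool} {i : Fin m} (h : (φ i).Sat x) :
    0 < degree φ x := by
  classical
  exact Finset.card_pos.2 ⟨i, by simpa using h⟩

theorem weight_nonneg {q : ℕ} (φ : DNF n m) (z : Fin q → ZMod 2) : 0 ≤ weight φ z := by
  unfold weight
  split <;> positivity

variable [NeZero m]

/-- A geometric waiting time divided by `m` has mean `1/d` and variance `(1 - d/m)/d²`, where `d` is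
the degree of `x`. A quadratic potential therefore passes through the loop with exactly these
corrections. The hypothesis `hfH` deals with the cutoff: once `H` is reached, the potential may be
evaluated as if any further amount `a ≥ 0` had been added. -/
theorem expect_checkSATLoop_le (φ : DNF n m) (x : Fin n → Bool) (count H k s V : ℝ)
    (f : ℝ → ℝ≥0∞) (hd : 0 < degree φ x) (hk : 0 ≤ k) (hV : 0 ≤ V) (hc : 0 ≤ count)
    (hf : ∀ y, 0 ≤ y → f y ≤ ENNReal.ofReal (k * ((count + y - s) ^ 2 + V)))
    (hfH : ∀ y a, 0 ≤ y → 0 ≤ a → H ≤ count + y →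
      f y ≤ ENNReal.ofReal (k * ((count + y + a - s) ^ 2 + V)))
    (fuel c : ℕ) (hfuel : m * H ≤ fuel + c) :
    expect (checkSATLoop φ x count H fuel c) f ≤
      ENNReal.ofReal (k * ((count + ((c : ℝ) / m + 1 / degree φ x) - s) ^ 2 +
        ((1 - (degree φ x : ℝ) / m) / (degree φ x : ℝ) ^ 2 + V))) := by
  classical
  have hm : (0 : ℝ) < m := Nat.cast_pos.2 (NeZero.pos m)
  have hd' : (0 : ℝ) < degree φ x := Nat.cast_pos.2 hd
  have hdm : (degree φ x : ℝ) ≤ m := Nat.cast_le.2 (degree_le φ x)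
  have hr : (degree φ x : ℝ) / m ≤ 1 := (div_le_one hm).2 hdm
  have hvar : 0 ≤ (1 - (degree φ x : ℝ) / m) / (degree φ x : ℝ) ^ 2 :=
    div_nonneg (by linarith) (by positivity)
  -- At the cutoff the samples that were not drawn are replaced by their mean, `a = 1/d`, and the
  -- variance term is given away.
  have hlast : ∀ c : ℕ, H ≤ count + (c : ℝ) / m → f ((c : ℝ) / m) ≤
      ENNReal.ofReal (k * ((count + ((c : ℝ) / m + 1 / degree φ x) - s) ^ 2 +
        ((1 - (degree φ x : ℝ) / m) / (degree φ x : ℝ) ^ 2 + V))) := by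
    intro c h
    refine (hfH _ (1 / degree φ x) (by positivity) (by positivity) h).trans ?_
    apply ENNReal.ofReal_le_ofReal
    apply mul_le_mul_of_nonneg_left _ hk
    rw [← add_assoc count]
    linarith
  induction fuel generalizing c with
  | zero =>
    rw [checkSATLoop, expect_pure]
    apply hlast
    -- The fuel runs out only after the samples for this vector alone have reached `H`.
    have : H ≤ (c : ℝ) / m := by
      rw [le_div_iff₀ hm]
      push_cast at hfuel
      linarith
    linarith
  | succ fuel ih =>
    rw [checkSATLoop]
    split_ifs with h
    · rw [expect_bind, expect_uniform]
      set d : ℝ := (degree φ x : ℝ) with hddef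
      set A := k * ((count + ((c + 1 : ℕ) : ℝ) / m - s) ^ 2 + V) with hA
      set B := k * ((count + (((c + 1 : ℕ) : ℝ) / m + 1 / d) - s) ^ 2 +
        ((1 - d / m) / d ^ 2 + V)) with hB
      have hA0 : 0 ≤ A := mul_nonneg hk (by positivity)
      have hB0 : 0 ≤ B := mul_nonneg hk (by positivity)
      have hterm : ∀ j : Fin m, expect (if (φ j).Sat x then (pure (((c + 1 : ℕ) : ℝ) / m) : PMF ℝ)
          else checkSATLoop φ x count H fuel (c + 1)) f ≤
          ENNReal.ofReal (if (φ j).Sat x then A else B) := by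
        intro j
        split_ifs with hj
        · rw [expect_pure]
          exact hf _ (by positivity)
        · exact ih (c + 1) (by push_cast at hfuel ⊢; linarith)
      calc _ ≤ (Fintype.card (Fin m) : ℝ≥0∞)⁻¹ *
            ∑ j : Fin m, ENNReal.ofReal (if (φ j).Sat x then A else B) := by
            gcongr with j
            exact hterm j
        _ = ENNReal.ofReal ((m : ℝ)⁻¹ * ∑ j : Fin m, (if (φ j).Sat x then A else B)) := by
            rw [ENNReal.ofReal_mul (by positivity), ENNReal.ofReal_inv_of_pos hm,
              ENNReal.ofReal_natCast, ENNReal.ofReal_sum_of_nonneg, Fintype.card_fin]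
            intro j _
            split_ifs <;> assumption
        -- Conditioning on the next cube: with `d` the degree, `(d/m) A + (1 - d/m) B` is the
        -- quadratic with the mean and variance of the whole remaining waiting time.
        _ = _ := by
            congr 1
            have hcard : ((Finset.univ.filter fun j => (φ j).Sat x).card : ℝ) = d := by
              rw [hddef, degree]
            have hcard' : ((Finset.univ.filter fun j => ¬ (φ j).Sat x).card : ℝ) = m - d := by
              have := Finset.card_filter_add_card_filter_not (s := (Finset.univ : Finset (Fin m)))
                (fun j => (φ j).Sat x)
              rw [Finset.card_univ, Fintype.card_fin] at this
              have h2 := congrArg (Nat.cast (R := ℝ)) this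
              push_cast at h2
              linarith
            rw [Finset.sum_ite, Finset.sum_const, Finset.sum_const, nsmul_eq_mul, nsmul_eq_mul,
              hcard, hcard', hA, hB]
            push_cast
            field_simp
            ring
    · rw [expect_pure]
      exact hlast c (not_lt.1 h)

theorem expect_checkSAT_le (φ : DNF n m) (x : Fin n → Bool) (count H k s V : ℝ)
    (f : ℝ → ℝ≥0∞) (hd : 0 < degree φ x) (hk : 0 ≤ k) (hV : 0 ≤ V) (hc : 0 ≤ count)
    (hf : ∀ y, 0 ≤ y → f y ≤ ENNReal.ofReal (k * ((count + y - s) ^ 2 + V)))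
    (hfH : ∀ y a, 0 ≤ y → 0 ≤ a → H ≤ count + y →
      f y ≤ ENNReal.ofReal (k * ((count + y + a - s) ^ 2 + V))) :
    expect (checkSAT φ x count H) f ≤
      ENNReal.ofReal (k * ((count + 1 / degree φ x - s) ^ 2 +
        ((1 - (degree φ x : ℝ) / m) / (degree φ x : ℝ) ^ 2 + V))) := by
  have := expect_checkSATLoop_le φ x count H k s V f hd hk hV hc hf hfH ⌈m * H⌉₊ 0
    (by simpa using Nat.le_ceil _)
  simpa [checkSAT] using this

/-- The pair `(u, v)` in round `j` of the enumeration of a cell. -/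
noncomputable def cellState {p l : ℕ} (D : Matrix (Fin p) (Fin l) (ZMod 2))
    (uv : (Fin p → ZMod 2) × (Fin l → ZMod 2)) : ℕ → (Fin p → ZMod 2) × (Fin l → ZMod 2)
  | 0 => uv
  | j + 1 => enumNextREX D (cellState D uv j) (nextGrayBit j)

theorem weightVar_nonneg {q : ℕ} (φ : DNF n m) (z : Fin q → ZMod 2) : 0 ≤ weightVar φ z := by
  unfold weightVar
  split
  · rename_i x i h
    have hm : (0 : ℝ) < m := Nat.cast_pos.2 (NeZero.pos m)
    have hdm : (degree φ x : ℝ) ≤ m := Nat.cast_le.2 (degree_le φ x)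
    have hr : (degree φ x : ℝ) / m ≤ 1 := (div_le_one hm).2 hdm
    exact div_nonneg (by linarith) (by positivity)
  · exact le_rfl

/-- Chebyshev's inequality for the cut-off count. The potential, squared distance of the predicted
final count from `s` plus the remaining variance, does not increase in expectation, and at the end
it is at least `d²` on `S`. Cutting off is harmless by `hSH`: if `H` is in `S`, every overrun of `H`
is also at distance at least `d` from `s`. -/
theorem prob_bsatLoop_le {q p : ℕ} (φ : DNF n m) (H s d : ℝ) (S : Set ℝ) (hd : 0 < d)
    (hS : ∀ y ∈ S, 0 ≤ y → y < H → d ≤ |y - s|) (hSH : H ∈ S → s + d ≤ H)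
    (D : Matrix (Fin p) (Fin (q - p)) (ZMod 2)) (uv : (Fin p → ZMod 2) × (Fin (q - p) → ZMod 2))
    (todo j : ℕ) (count : ℝ) (hc : 0 ≤ count) (hcH : count < H) :
    prob (bsatLoop φ H D todo j count (cellState D uv j)) S ≤ ENNReal.ofReal ((d ^ 2)⁻¹ *
      ((count + ∑ i ∈ Finset.range todo,
          weight φ (joinBits (cellState D uv (j + i)).1 (cellState D uv (j + i)).2) - s) ^ 2 +
        ∑ i ∈ Finset.range todo,
          weightVar φ (joinBits (cellState D uv (j + i)).1 (cellState D uv (j + i)).2))) := by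
  induction todo generalizing j count with
  | zero =>
    rw [bsatLoop, prob, expect_pure]
    by_cases h : count ∈ S
    · rw [Set.indicator_of_mem h, Pi.one_apply, ← ENNReal.ofReal_one]
      apply ENNReal.ofReal_le_ofReal
      have := hS _ h hc hcH
      rw [inv_mul_eq_div, le_div_iff₀ (by positivity)]
      simp only [Finset.range_zero, Finset.sum_empty, add_zero, one_mul]
      rw [← sq_abs (count - s)]
      gcongr
    · rw [Set.indicator_of_notMem h]
      exact zero_le
  | succ todo ih =>
    set W := ∑ i ∈ Finset.range todo,
          weight φ (joinBits (cellState D uv (j + (i + 1))).1 (cellState D uv (j + (i + 1))).2) with hW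
    set V := ∑ i ∈ Finset.range todo,
          weightVar φ (joinBits (cellState D uv (j + (i + 1))).1 (cellState D uv (j + (i + 1))).2) with hV
    have hW0 : 0 ≤ W := Finset.sum_nonneg fun _ _ => weight_nonneg φ _
    have hV0 : 0 ≤ V := Finset.sum_nonneg fun _ _ => weightVar_nonneg φ _
    have hk : 0 ≤ (d ^ 2)⁻¹ := by positivity
    rw [Finset.sum_range_succ', Finset.sum_range_succ']
    simp only [add_zero]
    rw [← hW, ← hV]
    have e1 : ∀ i, j + 1 + i = j + (i + 1) := fun i => by omega
    -- The outcome after the present vector. The mean `W` of the later vectors is absorbed by moving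
    -- the centre to `s - W`.
    set f : ℝ → ℝ≥0∞ := fun c => prob (if H ≤ count + c then pure H else
      bsatLoop φ H D todo (j + 1) (count + c) (cellState D uv (j + 1))) S with hfdef
    have hfH : ∀ y a, 0 ≤ y → 0 ≤ a → H ≤ count + y →
        f y ≤ ENNReal.ofReal ((d ^ 2)⁻¹ * ((count + y + a - (s - W)) ^ 2 + V)) := by
      intro y a hy ha hH
      simp only [hfdef, if_pos hH, prob, expect_pure]
      by_cases h : H ∈ S
      · rw [Set.indicator_of_mem h, Pi.one_apply, ← ENNReal.ofReal_one]
        apply ENNReal.ofReal_le_ofReal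
        have := hSH h
        rw [inv_mul_eq_div, le_div_iff₀ (by positivity), one_mul]
        have : d ^ 2 ≤ (count + y + a - (s - W)) ^ 2 := by
          gcongr
          linarith
        linarith
      · rw [Set.indicator_of_notMem h]
        exact zero_le
    have hf : ∀ y, 0 ≤ y →
        f y ≤ ENNReal.ofReal ((d ^ 2)⁻¹ * ((count + y - (s - W)) ^ 2 + V)) := by
      intro y hy
      by_cases hH : H ≤ count + y
      · simpa using hfH y 0 hy le_rfl hH
      · simp only [hfdef, if_neg hH]
        refine (ih (j + 1) (count + y) (by linarith) (not_le.1 hH)).trans (le_of_eq ?_)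
        simp only [e1]
        rw [← hW, ← hV, show count + y - (s - W) = count + y + W - s by ring]
    have hstep : prob (bsatLoop φ H D (todo + 1) j count (cellState D uv j)) S =
        expect (match interpret φ (joinBits (cellState D uv j).1 (cellState D uv j).2) with
          | some (x, _) => checkSAT φ x count H
          | none => pure 0) f := by
      rw [bsatLoop, prob]
      cases interpret φ (joinBits (cellState D uv j).1 (cellState D uv j).2) with
      | none =>
        simp only
        rw [expect_bind]
        rfl
      | some x =>
        simp only
        rw [expect_bind]
        rfl
    rw [hstep]
    unfold weight weightVar
    cases hint : interpret φ (joinBits (cellState D uv j).1 (cellState D uv j).2) with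
    | none =>
      simp only
      rw [expect_pure]
      refine (hf 0 le_rfl).trans (le_of_eq ?_)
      ring_nf
    | some x =>
      obtain ⟨x, i⟩ := x
      simp only
      refine (expect_checkSAT_le φ x count H _ (s - W) V f (degree_pos (sat_of_interpret hint))
        hk hV0 hc hf hfH).trans (le_of_eq ?_)
      congr 2
      ring

end SymbolicDNF

namespace SymbolicDNF

variable {n m : ℕ}

/-! ### The Gray code enumerates all the vectors of a cell -/

/-- Each bit is the parity of its number of flips; this closed form makes the words comparable. -/
theorem cellState_snd {p l : ℕ} (D : Matrix (Fin p) (Fin l) (ZMod 2)) (u : Fin p → ZMod 2)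
    (j : ℕ) (k : Fin l) : (cellState D (u, 0) j).2 k =
      ∑ t ∈ Finset.range j, if padicValNat 2 (t + 1) = (k : ℕ) then 1 else 0 := by
  induction j with
  | zero => simp [cellState]
  | succ j ih =>
    rw [Finset.sum_range_succ, ← ih, cellState, enumNextREX, nextGrayBit]
    split_ifs with h1 h2 h2
    · have : k = ⟨padicValNat 2 (j + 1), h1⟩ := Fin.ext h2.symm
      subst this
      simp
    · have : k ≠ ⟨padicValNat 2 (j + 1), h1⟩ := fun h => h2 (by rw [h])
      simp [this]
    · exact absurd k.2 (by omega)
    · simp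

theorem cellState_fst {p l : ℕ} (D : Matrix (Fin p) (Fin l) (ZMod 2)) (u : Fin p → ZMod 2)
    (j : ℕ) (i : Fin p) : (cellState D (u, 0) j).1 i =
      u i + ∑ k, D i k * (cellState D (u, 0) j).2 k := by
  induction j with
  | zero => simp [cellState]
  | succ j ih =>
    rw [cellState, enumNextREX]
    split_ifs with h
    · simp only
      rw [ih, ← Finset.add_sum_erase Finset.univ (fun k => D i k * (cellState D (u, 0) j).2 k)
          (Finset.mem_univ ⟨nextGrayBit j, h⟩),
        ← Finset.add_sum_erase Finset.univ (fun k => D i k * Function.update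
          (cellState D (u, 0) j).2 ⟨nextGrayBit j, h⟩
            ((cellState D (u, 0) j).2 ⟨nextGrayBit j, h⟩ + 1) k)
          (Finset.mem_univ ⟨nextGrayBit j, h⟩), Function.update_self]
      have : ∑ x ∈ Finset.univ.erase ⟨nextGrayBit j, h⟩, D i x *
          Function.update (cellState D (u, 0) j).2 ⟨nextGrayBit j, h⟩
            ((cellState D (u, 0) j).2 ⟨nextGrayBit j, h⟩ + 1) x =
          ∑ x ∈ Finset.univ.erase ⟨nextGrayBit j, h⟩, D i x * (cellState D (u, 0) j).2 x := by
        apply Finset.sum_congr rfl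
        intro x hx
        rw [Function.update_of_ne (Finset.ne_of_mem_erase hx)]
      rw [this]
      ring
    · exact ih

/-- In a nonempty interval of positive integers, the largest 2-adic valuation occurs only once. -/
theorem exists_unique_max_valuation {i j : ℕ} (h : i < j) :
    ∃ t₀ ∈ Finset.Ioc i j, ∀ t ∈ Finset.Ioc i j,
      padicValNat 2 t = padicValNat 2 t₀ → t = t₀ := by
  obtain ⟨t₀, ht₀, hmax⟩ := Finset.exists_max_image (Finset.Ioc i j) (padicValNat 2)
    ⟨j, by simp [h]⟩
  refine ⟨t₀, ht₀, ?_⟩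
  have key : ∀ a ∈ Finset.Ioc i j, ∀ b ∈ Finset.Ioc i j, a < b →
      padicValNat 2 a = padicValNat 2 t₀ → padicValNat 2 b = padicValNat 2 t₀ → False := by
    intro a ha b hb hab hva hvb
    set k := padicValNat 2 t₀
    rw [Finset.mem_Ioc] at ha hb
    obtain ⟨a', rfl⟩ : 2 ^ k ∣ a := (padicValNat_dvd_iff_le (by omega)).2 hva.ge
    obtain ⟨b', rfl⟩ : 2 ^ k ∣ b := (padicValNat_dvd_iff_le (by omega)).2 hvb.ge
    have hodd : ¬ 2 ∣ a' := by
      rintro ⟨c, rfl⟩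
      have : 2 ^ (k + 1) ∣ 2 ^ k * (2 * c) := ⟨c, by ring⟩
      rw [padicValNat_dvd_iff_le (by omega)] at this
      omega
    have hab' : a' < b' := lt_of_mul_lt_mul_left hab (Nat.zero_le _)
    -- As `a'` is odd, `a' + 1` is even, so the next multiple of `2 ^ k` has a larger valuation and
    -- still lies in the interval.
    have hmem : 2 ^ k * (a' + 1) ∈ Finset.Ioc i j := by
      rw [Finset.mem_Ioc]
      constructor
      · nlinarith [Nat.pos_of_neZero (2 ^ k)]
      · exact (Nat.mul_le_mul_left _ hab').trans hb.2
    have hle := hmax _ hmem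
    have : 2 ^ (k + 1) ∣ 2 ^ k * (a' + 1) := by
      rw [pow_succ]
      exact Nat.mul_dvd_mul_left _ (by omega)
    rw [padicValNat_dvd_iff_le (by positivity)] at this
    omega
  intro t ht hv
  rcases lt_trichotomy t t₀ with hlt | heq | hgt
  · exact (key t ht t₀ ht₀ hlt hv rfl).elim
  · exact heq
  · exact (key t₀ ht₀ t ht hgt rfl hv).elim

/-- Between rounds `i` and `j` the bit given by the largest valuation in `(i, j]` is flipped exactly
once, so the two words differ there. -/
theorem cellState_snd_injOn {p l : ℕ} (D : Matrix (Fin p) (Fin l) (ZMod 2))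
    (u : Fin p → ZMod 2) {i j : ℕ} (hij : i < j) (hj : j < 2 ^ l) :
    (cellState D (u, 0) i).2 ≠ (cellState D (u, 0) j).2 := by
  intro heq
  obtain ⟨t₀, ht₀, huniq⟩ := exists_unique_max_valuation hij
  rw [Finset.mem_Ioc] at ht₀
  have hk : padicValNat 2 t₀ < l := by
    have h1 : 2 ^ padicValNat 2 t₀ ∣ t₀ := pow_padicValNat_dvd
    have h2 := Nat.le_of_dvd (by omega) h1
    exact (Nat.pow_lt_pow_iff_right (by norm_num)).1 (h2.trans_lt (ht₀.2.trans_lt hj))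
  have h := congrFun heq ⟨padicValNat 2 t₀, hk⟩
  rw [cellState_snd, cellState_snd, ← Finset.sum_range_add_sum_Ico _ hij.le] at h
  have hsum : ∑ t ∈ Finset.Ico i j,
      (if padicValNat 2 (t + 1) = padicValNat 2 t₀ then (1 : ZMod 2) else 0) = 1 := by
    rw [Finset.sum_eq_single_of_mem (t₀ - 1)]
    · rw [Nat.sub_add_cancel (by omega), if_pos rfl]
    · rw [Finset.mem_Ico]; omega
    · intro t ht hne
      rw [Finset.mem_Ico] at ht
      rw [if_neg]
      intro hv
      have := huniq (t + 1) (by rw [Finset.mem_Ioc]; omega) hv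
      omega
  simp only at h
  rw [hsum] at h
  simp at h

theorem sum_cellState {p l : ℕ} (D : Matrix (Fin p) (Fin l) (ZMod 2)) (u : Fin p → ZMod 2)
    (g : (Fin p → ZMod 2) × (Fin l → ZMod 2) → ℝ) :
    ∑ j ∈ Finset.range (2 ^ l), g (cellState D (u, 0) j) =
      ∑ v, g (fun i => u i + ∑ k, D i k * v k, v) := by
  have hst : ∀ j, cellState D (u, 0) j =
      (fun i => u i + ∑ k, D i k * (cellState D (u, 0) j).2 k, (cellState D (u, 0) j).2) := by
    intro j
    ext i
    · exact cellState_fst D u j i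
    · rfl
  rw [← Fin.sum_univ_eq_sum_range (fun j => g (cellState D (u, 0) j))]
  have hinj : Function.Injective fun j : Fin (2 ^ l) => (cellState D (u, 0) j).2 := by
    intro i j hij
    rcases lt_trichotomy (i : ℕ) j with h | h | h
    · exact (cellState_snd_injOn D u h j.2 hij).elim
    · exact Fin.ext h
    · exact (cellState_snd_injOn D u h i.2 hij.symm).elim
  have hbij := (Fintype.bijective_iff_injective_and_card _).2 ⟨hinj, by simp [ZMod.card]⟩
  rw [← hbij.sum_comp (fun v => g (fun i => u i + ∑ k, D i k * v k, v))]
  apply Finset.sum_congr rfl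
  intro j _
  exact congrArg g (hst j)

/-- The cell of a row-echelon hash function. -/
def HashCell.Mem {q p : ℕ} (h : HashCell q p) (hp : p ≤ q) (z : Fin q → ZMod 2) : Prop :=
  ∀ i : Fin p, z (Fin.castLE hp i) =
    h.b i + h.y i + ∑ k : Fin (q - p), h.D i k * z ⟨p + k, by omega⟩

open Classical in
theorem sum_joinBits {q p : ℕ} (h : HashCell q p) (hp : p ≤ q) (g : (Fin q → ZMod 2) → ℝ) :
    ∑ v, g (joinBits (fun i => (h.b + h.y) i + ∑ k, h.D i k * v k) v) =
      ∑ z, if h.Mem hp z then g z else 0 := by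
  rw [← Finset.sum_filter]
  have hv : ∀ (u : Fin p → ZMod 2) (v : Fin (q - p) → ZMod 2) (k : Fin (q - p)),
      joinBits u v ⟨p + k, by omega⟩ = v k := by
    intro u v k
    simp [joinBits]
  have hu : ∀ (u : Fin p → ZMod 2) (v : Fin (q - p) → ZMod 2) (i : Fin p),
      joinBits u v (Fin.castLE hp i) = u i := by
    intro u v i
    simp [joinBits]
  refine Finset.sum_bij' (fun v _ => joinBits (fun i => (h.b + h.y) i + ∑ k, h.D i k * v k) v)
    (fun z _ k => z ⟨p + k, by omega⟩) ?_ ?_ ?_ ?_ ?_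
  · intro v _
    rw [Finset.mem_filter]
    refine ⟨Finset.mem_univ _, fun i => ?_⟩
    simp only [hv, hu]
    rfl
  · intro z _
    exact Finset.mem_univ _
  · intro v _
    funext k
    exact hv _ _ _
  · intro z hz
    rw [Finset.mem_filter] at hz
    funext k
    by_cases hk : (k : ℕ) < p
    · simp only [joinBits, hk, dif_pos]
      have := hz.2 ⟨k, hk⟩
      rw [show Fin.castLE hp ⟨k, hk⟩ = k from Fin.ext rfl] at this
      rw [this]
      rfl
    · simp only [joinBits, hk, dif_neg, not_false_eq_true]
      congr 1
      exact Fin.ext (by simp; omega)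
  · intro v _
    rfl

open scoped ENNReal

open Classical in
theorem prob_bsat_le [NeZero m] {q sI : ℕ} (φ : DNF n m) (B : Base q sI) (H s d : ℝ)
    (S : Set ℝ) (hd : 0 < d) (hH : 0 < H)
    (hS : ∀ y ∈ S, 0 ≤ y → y < H → d ≤ |y - s|) (hSH : H ∈ S → s + d ≤ H)
    (p : ℕ) (hp : p ≤ q) :
    prob (bsat φ B H p) S ≤ ENNReal.ofReal ((d ^ 2)⁻¹ *
      ((∑ z, (if (extract B p).Mem hp z then weight φ z else 0) - s) ^ 2 +
        ∑ z, if (extract B p).Mem hp z then weightVar φ z else 0)) := by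
  have := prob_bsatLoop_le φ H s d S hd hS hSH (extract B p).D
    ((extract B p).b + (extract B p).y, 0) (2 ^ (q - p)) 0 0 le_rfl hH
  simp only [zero_add] at this
  rw [sum_cellState _ _ (fun uv => weight φ (joinBits uv.1 uv.2)),
    sum_cellState _ _ (fun uv => weightVar φ (joinBits uv.1 uv.2)),
    sum_joinBits _ hp, sum_joinBits _ hp] at this
  exact this

/-! ### Gaussian elimination does not change the cell -/

/-- The value of row `r` of the affine system `[I | D] z + b + y` given by the working arrays. -/
def rowDefect (sI l : ℕ) (W : Work) (z : ℕ → ZMod 2) (r : ℕ) : ZMod 2 :=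
  (if r < sI then z r else 0) + ∑ k ∈ Finset.range l, W.D r k * z (sI + k) + W.b r + W.y r

/-- A pivot row `i ≥ sI` is zero in the first `sI` columns, so adding it leaves the implicit
identity block intact. -/
theorem rowDefect_eliminate (sI l i j : ℕ) (W : Work) (z : ℕ → ZMod 2) (hi : sI ≤ i) (r : ℕ) :
    rowDefect sI l (eliminate sI i W j) z r = rowDefect sI l W z r +
      if r = j ∧ W.D j (i - sI) = 1 then rowDefect sI l W z i else 0 := by
  unfold eliminate
  by_cases h : W.D j (i - sI) = 1
  · rw [if_pos h]
    by_cases hr : r = j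
    · subst hr
      simp only [rowDefect, h, Function.update_self, and_self, if_true, Pi.add_apply, add_mul,
        Finset.sum_add_distrib, not_lt.2 hi, if_false]
      ring
    · simp [rowDefect, hr]
  · simp [h]

theorem forall_rowDefect_eliminate {sI l i j p : ℕ} (W : Work) (z : ℕ → ZMod 2) (hi : sI ≤ i)
    (hip : i < p) (hj : j < i) :
    (∀ r < p, rowDefect sI l (eliminate sI i W j) z r = 0) ↔
      ∀ r < p, rowDefect sI l W z r = 0 := by
  constructor
  · intro h r hr
    have hi0 := h i hip
    rw [rowDefect_eliminate _ _ _ _ _ _ hi, if_neg (by omega), add_zero] at hi0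
    have hr0 := h r hr
    rw [rowDefect_eliminate _ _ _ _ _ _ hi, hi0, ite_self, add_zero] at hr0
    exact hr0
  · intro h r hr
    rw [rowDefect_eliminate _ _ _ _ _ _ hi, h r hr, h i hip, ite_self, add_zero]

theorem forall_rowDefect_foldl_eliminate {sI l i p : ℕ} (z : ℕ → ZMod 2) (hi : sI ≤ i)
    (hip : i < p) (L : List ℕ) (hL : ∀ j ∈ L, j < i) (W : Work) :
    (∀ r < p, rowDefect sI l (L.foldl (eliminate sI i) W) z r = 0) ↔
      ∀ r < p, rowDefect sI l W z r = 0 := by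
  induction L generalizing W with
  | nil => rfl
  | cons j L ih =>
    rw [List.foldl_cons, ih (fun a ha => hL a (List.mem_cons_of_mem _ ha)),
      forall_rowDefect_eliminate W z hi hip (hL j List.mem_cons_self)]

theorem foldl_eliminate_D (sI i c : ℕ) (hc : c ≤ i) (W : Work) (r k : ℕ) :
    (((List.range c).foldl (eliminate sI i) W).D r k) =
      W.D r k + if r < c ∧ W.D r (i - sI) = 1 then W.D i k else 0 := by
  induction c generalizing r k with
  | zero => simp
  | succ c ih =>
    have ih := ih (by omega)
    rw [List.range_succ, List.foldl_append, List.foldl_cons, List.foldl_nil]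
    set W' := (List.range c).foldl (eliminate sI i) W
    have hD : (eliminate sI i W' c).D r k = W'.D r k +
        if r = c ∧ W'.D c (i - sI) = 1 then W'.D i k else 0 := by
      unfold eliminate
      by_cases h : W'.D c (i - sI) = 1
      · rw [if_pos h]
        by_cases hr : r = c
        · subst hr; simp [h]
        · simp [hr]
      · simp [h]
    rw [hD, ih, ih, ih, if_neg (show ¬ (c < c ∧ _) by omega),
      if_neg (show ¬ (i < c ∧ _) by omega), add_zero, add_zero, add_assoc]
    congr 1
    by_cases hr : r = c
    · subst hr; simp
    · by_cases h2 : r < c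
      · simp [hr, h2, show r < c + 1 by omega]
      · simp [hr, h2, show ¬ r < c + 1 by omega]

/-- The rows before `i` are reduced and the rows from `i` on are unit upper triangular. -/
def PartlyReduced (sI R i : ℕ) (W : Work) : Prop :=
  (∀ r k, r < i → k < i - sI → W.D r k = if r = sI + k then 1 else 0) ∧
    (∀ r k, i ≤ r → r < R → k < r - sI → W.D r k = 0) ∧
    ∀ r, i ≤ r → r < R → W.D r (r - sI) = 1

theorem PartlyReduced.step {sI R i : ℕ} {W : Work} (h : PartlyReduced sI R i W) (hi : sI ≤ i)
    (hR : i < R) : PartlyReduced sI R (i + 1) ((List.range i).foldl (eliminate sI i) W) := by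
  obtain ⟨h1, h2, h3⟩ := h
  refine ⟨?_, ?_, ?_⟩
  · intro r k hr hk
    rw [foldl_eliminate_D _ _ _ le_rfl]
    rcases Nat.lt_succ_iff_lt_or_eq.1 hr with hr' | rfl
    · rcases (show k < i - sI ∨ k = i - sI by omega) with hk' | rfl
      · rw [h1 r k hr' hk', h2 i k le_rfl hR hk', ite_self, add_zero]
      · rw [h3 i le_rfl hR, if_neg (show r ≠ sI + (i - sI) by omega)]
        -- The pivot is one, so the conditional addition clears the entry above it.
        have h01 : ∀ x : ZMod 2, x + (if x = 1 then 1 else 0) = 0 := by decide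
        simpa [hr'] using h01 (W.D r (i - sI))
    · rw [if_neg (by omega), add_zero]
      rcases (show k < r - sI ∨ k = r - sI by omega) with hk' | rfl
      · rw [h2 r k le_rfl hR hk', if_neg (by omega)]
      · rw [h3 r le_rfl hR, if_pos (by omega)]
  · intro r k hr hrR hk
    rw [foldl_eliminate_D _ _ _ le_rfl, if_neg (by omega), add_zero]
    exact h2 r k (by omega) hrR hk
  · intro r hr hrR
    rw [foldl_eliminate_D _ _ _ le_rfl, if_neg (by omega), add_zero]
    exact h3 r (by omega) hrR

theorem partlyReduced_foldl {sI R : ℕ} {W : Work} (h : PartlyReduced sI R sI W) (c : ℕ)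
    (hc : sI + c ≤ R) :
    PartlyReduced sI R (sI + c) ((List.range' sI c).foldl
      (fun W i => (List.range i).foldl (eliminate sI i) W) W) := by
  induction c with
  | zero => simpa using h
  | succ c ih =>
    rw [List.range'_concat, List.foldl_append, List.foldl_cons, List.foldl_nil, one_mul]
    exact (ih (by omega)).step (by omega) (by omega)

theorem forall_rowDefect_foldl {sI l p : ℕ} (W : Work) (z : ℕ → ZMod 2) (c : ℕ)
    (hc : sI + c ≤ p) :
    (∀ r < p, rowDefect sI l ((List.range' sI c).foldl
      (fun W i => (List.range i).foldl (eliminate sI i) W) W) z r = 0) ↔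
      ∀ r < p, rowDefect sI l W z r = 0 := by
  induction c with
  | zero => simp
  | succ c ih =>
    rw [List.range'_concat, List.foldl_append, List.foldl_cons, List.foldl_nil, one_mul,
      forall_rowDefect_foldl_eliminate z (by omega) (by omega) _ (fun j hj => List.mem_range.1 hj),
      ih (by omega)]

theorem zmod_two_add_eq_zero (x y : ZMod 2) : x + y = 0 ↔ x = y := by
  rw [CharTwo.add_eq_zero]

theorem partlyReduced_baseMatrix {q sI : ℕ} (G : Matrix (Fin sI) (Fin (q - sI)) (ZMod 2))
    (F : Matrix (Fin (q - sI - 1)) (Fin (q - sI)) (ZMod 2)) (b y : Fin (q - 1) → ZMod 2) :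
    PartlyReduced sI (q - 1) sI (Base.toWork ⟨baseMatrix q sI G F, b, y⟩ : Work) := by
  refine ⟨fun r k _ hk => absurd hk (by omega), ?_, ?_⟩
  · intro r k hr hrR hk
    simp only [Base.toWork, baseMatrix]
    rw [dif_pos ⟨hrR, by omega⟩, dif_neg (by omega), if_neg (show ¬ k = r - sI by omega),
      if_pos (show k < r - sI from hk)]
  · intro r hr hrR
    simp only [Base.toWork, baseMatrix]
    rw [dif_pos ⟨hrR, by omega⟩, dif_neg (by omega)]
    exact if_pos trivial

/-- A bit vector as a sequence of bits. -/
def extendBits {q : ℕ} (z : Fin q → ZMod 2) (i : ℕ) : ZMod 2 := if h : i < q then z ⟨i, h⟩ else 0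

/-- The cell consists of the solutions of the first `p` equations before the elimination. -/
theorem mem_extract_iff {q sI p : ℕ} (G : Matrix (Fin sI) (Fin (q - sI)) (ZMod 2))
    (F : Matrix (Fin (q - sI - 1)) (Fin (q - sI)) (ZMod 2)) (b y : Fin (q - 1) → ZMod 2)
    (hsp : sI ≤ p) (hpq : p ≤ q - 1) (z : Fin q → ZMod 2) :
    (extract (⟨baseMatrix q sI G F, b, y⟩ : Base q sI) p).Mem (hpq.trans (Nat.sub_le _ _)) z ↔
      ∀ r < p, rowDefect sI (q - sI) (Base.toWork (⟨baseMatrix q sI G F, b, y⟩ : Base q sI))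
        (extendBits z) r = 0 := by
  rw [← forall_rowDefect_foldl _ _ (p - sI) (by omega)]
  have hred := partlyReduced_foldl (partlyReduced_baseMatrix G F b y) (p - sI) (by omega)
  rw [Nat.add_sub_cancel' hsp] at hred
  simp only [extract, HashCell.Mem]
  set W := (List.range' sI (p - sI)).foldl
    (fun W i => (List.range i).foldl (eliminate sI i) W)
    (Base.toWork (⟨baseMatrix q sI G F, b, y⟩ : Base q sI)) with hW
  have hdef : ∀ r (hr : r < p), rowDefect sI (q - sI) W (extendBits z) r =
      z ⟨r, by omega⟩ + (W.b r + W.y r + ∑ k : Fin (q - p), W.D r (p - sI + k) *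
        z ⟨p + k, by omega⟩) := by
    intro r hr
    unfold rowDefect
    -- The first `p - sI` stored columns have become unit columns and together with the identity
    -- block give the bit `z r`; the last `q - p` columns are the extracted matrix.
    rw [show q - sI = (p - sI) + (q - p) by omega, Finset.sum_range_add]
    have e1 : (if r < sI then extendBits z r else 0) +
        ∑ k ∈ Finset.range (p - sI), W.D r k * extendBits z (sI + k) = z ⟨r, by omega⟩ := by
      have e : ∀ k ∈ Finset.range (p - sI), W.D r k * extendBits z (sI + k) =
          if r = sI + k then extendBits z r else 0 := by
        intro k hk
        rw [hred.1 r k hr (Finset.mem_range.1 hk)]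
        split_ifs with h
        · rw [h, one_mul]
        · rw [zero_mul]
      rw [Finset.sum_congr rfl e]
      have hz : extendBits z r = z ⟨r, by omega⟩ := dif_pos _
      by_cases hrs : r < sI
      · rw [if_pos hrs, Finset.sum_eq_zero, add_zero, hz]
        intro k _
        rw [if_neg (by omega)]
      · rw [if_neg hrs, zero_add, Finset.sum_eq_single_of_mem (r - sI)
          (Finset.mem_range.2 (by omega)), if_pos (by omega), hz]
        intro k _ hk
        rw [if_neg (by omega)]
    have e2 : ∑ k ∈ Finset.range (q - p), W.D r (p - sI + k) * extendBits z (sI + (p - sI + k)) =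
        ∑ k : Fin (q - p), W.D r (p - sI + k) * z ⟨p + k, by omega⟩ := by
      rw [← Fin.sum_univ_eq_sum_range
        (fun k => W.D r (p - sI + k) * extendBits z (sI + (p - sI + k)))]
      apply Finset.sum_congr rfl
      intro k _
      rw [show sI + (p - sI + (k : ℕ)) = p + k by omega]
      rw [extendBits, dif_pos (by omega)]
    rw [← add_assoc, e1, e2]
    ring
  constructor
  · intro h r hr
    rw [hdef r hr, zmod_two_add_eq_zero]
    exact h ⟨r, hr⟩
  · intro h i
    have := h i i.2
    rw [hdef i i.2, zmod_two_add_eq_zero] at this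
    exact this

end SymbolicDNF

namespace SymbolicDNF

open scoped ENNReal

variable {n m : ℕ}

/-! ### Pairwise independence of the random cells -/

/-- The sample space of the hash functions and cells. -/
abbrev BaseSpace (q sI : ℕ) : Type :=
  Matrix (Fin sI) (Fin (q - sI)) (ZMod 2) × Matrix (Fin (q - sI - 1)) (Fin (q - sI)) (ZMod 2) ×
    (Fin (q - 1) → ZMod 2) × (Fin (q - 1) → ZMod 2)

/-- The hash function and cell of a point of the sample space. -/
def BaseSpace.base {q sI : ℕ} (ω : BaseSpace q sI) : Base q sI :=
  ⟨baseMatrix q sI ω.1 ω.2.1, ω.2.2.1, ω.2.2.2⟩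

theorem expect_sampleBase (q sI : ℕ) (f : Base q sI → ℝ≥0∞) :
    expect (sampleBase q sI) f =
      (Fintype.card (BaseSpace q sI) : ℝ≥0∞)⁻¹ * ∑ ω : BaseSpace q sI, f ω.base := by
  rw [sampleBase, expect_bind]
  simp_rw [expect_bind, expect_pure, expect_uniform]
  simp_rw [Fintype.sum_prod_type, Fintype.card_prod, Nat.cast_mul]
  rw [ENNReal.mul_inv (by simp) (by simp), ENNReal.mul_inv (by simp) (by simp),
    ENNReal.mul_inv (by simp) (by simp)]
  simp_rw [Finset.mul_sum, mul_assoc]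
  rfl

/-- Translation by `e t` carries the fibre over `0` into the fibre over `t`, and translation by `e
(-t)` goes back, so all fibres have the same size. -/
theorem card_fiber_mul {Ω T : Type} [AddGroup Ω] [Fintype Ω] [AddGroup T] [Fintype T]
    [DecidableEq T] (f : Ω → T) (e : T → Ω) (h : ∀ ω t, f (ω + e t) = f ω + t) :
    (Finset.univ.filter fun ω => f ω = 0).card * Fintype.card T = Fintype.card Ω := by
  have hfib : ∀ t : T, (Finset.univ.filter fun ω => f ω = t).card =
      (Finset.univ.filter fun ω => f ω = 0).card := by
    intro t
    apply le_antisymm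
    · refine Finset.card_le_card_of_injOn (fun ω => ω + e (-t)) ?_ (add_left_injective _).injOn
      intro ω hω
      simp only [Finset.coe_filter, Finset.mem_univ, true_and, Set.mem_ofPred_eq] at hω ⊢
      rw [h, hω, add_neg_cancel]
    · refine Finset.card_le_card_of_injOn (fun ω => ω + e t) ?_ (add_left_injective _).injOn
      intro ω hω
      simp only [Finset.coe_filter, Finset.mem_univ, true_and, Set.mem_ofPred_eq] at hω ⊢
      rw [h, hω, zero_add]
  have := Finset.card_eq_sum_card_fiberwise (f := f) (s := Finset.univ) (t := Finset.univ)
    (fun _ _ => Finset.mem_coe.2 (Finset.mem_univ _))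
  rw [Finset.sum_congr rfl (fun t _ => hfib t), Finset.sum_const, smul_eq_mul, Finset.card_univ,
    Finset.card_univ] at this
  rw [this, mul_comm]

/-- Adding `s` to the column `κ` of the base matrix and `c` to the offset. -/
def columnShift (q sI κ : ℕ) (s c : ℕ → ZMod 2) : BaseSpace q sI :=
  (fun i j => if (j : ℕ) = κ then s i else 0, fun i j => if (j : ℕ) = κ then s (sI + i) else 0,
    fun i => c i, 0)

/-- The values of the first `p` rows at `z` of the affine system defining the cell. -/
def cellDefect {q sI : ℕ} (p : ℕ) (z : Fin q → ZMod 2) (ω : BaseSpace q sI) : Fin p → ZMod 2 :=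
  fun r => rowDefect sI (q - sI) ω.base.toWork (extendBits z) r

/-- The condition `p ≤ sI + κ` puts the entries of column `κ` in the first `p` rows either in `G` or
strictly above the diagonal, where they are free. -/
theorem cellDefect_add_columnShift {q sI p κ : ℕ} (hpq : p ≤ q - 1) (hκ : p ≤ sI + κ)
    (hκq : sI + κ < q) (s c : ℕ → ZMod 2) (z : Fin q → ZMod 2) (ω : BaseSpace q sI) (r : Fin p) :
    cellDefect p z (ω + columnShift q sI κ s c) r =
      cellDefect p z ω r + (s r * z ⟨sI + κ, hκq⟩ + c r) := by
  have hr : (r : ℕ) < q - 1 := r.2.trans_le hpq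
  have hD : ∀ k ∈ Finset.range (q - sI), (ω + columnShift q sI κ s c).base.toWork.D r k *
      extendBits z (sI + k) = ω.base.toWork.D r k * extendBits z (sI + k) +
        if k = κ then s r * z ⟨sI + κ, hκq⟩ else 0 := by
    intro k hk
    have hk' := Finset.mem_range.1 hk
    have hDk : (ω + columnShift q sI κ s c).base.toWork.D r k = ω.base.toWork.D r k +
        if k = κ then s r else 0 := by
      simp only [Base.toWork, BaseSpace.base, dif_pos (And.intro hr hk'), baseMatrix, columnShift,
        Prod.fst_add, Prod.snd_add]
      by_cases h1 : (r : ℕ) < sI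
      · simp only [dif_pos h1]
        rfl
      · simp only [dif_neg h1]
        have hrp := r.2
        by_cases h2 : k = r - sI
        · rw [if_pos h2, if_pos h2, if_neg (show k ≠ κ by omega), add_zero]
        · rw [if_neg h2, if_neg h2]
          by_cases h3 : k < r - sI
          · rw [if_pos h3, if_pos h3, if_neg (show k ≠ κ by omega), add_zero]
          · rw [if_neg h3, if_neg h3]
            change _ + (if k = κ then s (sI + (r - sI)) else 0) = _
            rw [show sI + ((r : ℕ) - sI) = r by omega]
    rw [hDk, add_mul]
    congr 1
    by_cases hkk : k = κ
    · subst hkk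
      rw [if_pos rfl, if_pos rfl, extendBits, dif_pos hκq]
    · rw [if_neg hkk, if_neg hkk, zero_mul]
  have hb : (ω + columnShift q sI κ s c).base.toWork.b r = ω.base.toWork.b r + c r := by
    simp only [Base.toWork, BaseSpace.base, dif_pos hr, columnShift, Prod.snd_add, Prod.fst_add]
    rfl
  have hy : (ω + columnShift q sI κ s c).base.toWork.y r = ω.base.toWork.y r := by
    simp only [Base.toWork, BaseSpace.base, dif_pos hr, columnShift, Prod.snd_add, add_zero]
  unfold cellDefect rowDefect
  rw [Finset.sum_congr rfl hD, Finset.sum_add_distrib, Finset.sum_ite_eq',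
    if_pos (Finset.mem_range.2 (by omega)), hb, hy]
  ring

theorem mem_extract_base_iff {q sI p : ℕ} (hsp : sI ≤ p) (hpq : p ≤ q - 1) (z : Fin q → ZMod 2)
    (ω : BaseSpace q sI) :
    (extract ω.base p).Mem (hpq.trans (Nat.sub_le _ _)) z ↔ cellDefect p z ω = 0 := by
  rw [BaseSpace.base, mem_extract_iff _ _ _ _ hsp hpq]
  constructor
  · intro h
    funext r
    exact h r r.2
  · intro h r hr
    exact congrFun h ⟨r, hr⟩

theorem extendBits_apply {p : ℕ} (t : Fin p → ZMod 2) (r : Fin p) : extendBits t r = t r :=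
  dif_pos r.2

open Classical in
theorem card_mem_extract {q sI p : ℕ} (hsp : sI ≤ p) (hpq : p ≤ q - 1) (hq : 0 < q)
    (z : Fin q → ZMod 2) :
    (Finset.univ.filter fun ω : BaseSpace q sI =>
      (extract ω.base p).Mem (hpq.trans (Nat.sub_le _ _)) z).card * 2 ^ p =
      Fintype.card (BaseSpace q sI) := by
  simp_rw [mem_extract_base_iff hsp hpq]
  have := card_fiber_mul (cellDefect (sI := sI) p z)
    (fun t => columnShift q sI (q - 1 - sI) 0 (extendBits t)) (by
      intro ω t
      funext r
      rw [cellDefect_add_columnShift hpq (by omega) (by omega)]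
      simp [extendBits_apply])
  rw [← this]
  simp [ZMod.card]

open Classical in
-- If `z` and `z'` differ in a free bit, their defects are jointly uniform. Otherwise they never
-- share a cell, since the free bits determine a vector of the cell; this is why there is only an
-- inequality.
theorem card_mem_mem_extract_le {q sI p : ℕ} (hsp : sI ≤ p) (hpq : p ≤ q - 1)
    {z z' : Fin q → ZMod 2} (hne : z ≠ z') :
    (Finset.univ.filter fun ω : BaseSpace q sI =>
      (extract ω.base p).Mem (hpq.trans (Nat.sub_le _ _)) z ∧
      (extract ω.base p).Mem (hpq.trans (Nat.sub_le _ _)) z').card * 4 ^ p ≤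
      Fintype.card (BaseSpace q sI) := by
  by_cases hk : ∃ k : Fin q, p ≤ k ∧ z k ≠ z' k
  · obtain ⟨k, hpk, hzk⟩ := hk
    have hk2 := k.2
    simp_rw [mem_extract_base_iff hsp hpq]
    have hlt : sI + ((k : ℕ) - sI) < q := by omega
    have hke : (⟨sI + ((k : ℕ) - sI), hlt⟩ : Fin q) = k :=
      Fin.ext (show sI + ((k : ℕ) - sI) = k by omega)
    -- The shift solves `s * z k + c = t.1` and `s * z' k + c = t.2`; as `z k ≠ z' k` in `ZMod 2`,
    -- this forces `s = t.1 + t.2`.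
    have := card_fiber_mul (fun ω : BaseSpace q sI => (cellDefect p z ω, cellDefect p z' ω))
      (fun t => columnShift q sI (k - sI) (extendBits (t.1 + t.2))
        (extendBits (t.1 + (z k) • (t.1 + t.2)))) (by
        intro ω t
        have hz : ∀ a b x y : ZMod 2, a ≠ b → (x + y) * a + (x + a * (x + y)) = x ∧
          (x + y) * b + (x + a * (x + y)) = y := by decide
        refine Prod.ext ?_ ?_
        · funext r
          change cellDefect p z _ r = cellDefect p z ω r + t.1 r
          rw [cellDefect_add_columnShift hpq (by omega) hlt, hke, extendBits_apply,
            extendBits_apply]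
          congr 1
          exact (hz (z k) (z' k) (t.1 r) (t.2 r) hzk).1
        · funext r
          change cellDefect p z' _ r = cellDefect p z' ω r + t.2 r
          rw [cellDefect_add_columnShift hpq (by omega) hlt, hke, extendBits_apply,
            extendBits_apply]
          congr 1
          exact (hz (z k) (z' k) (t.1 r) (t.2 r) hzk).2)
    rw [← this]
    apply le_of_eq
    simp only [Prod.mk_eq_zero, Fintype.card_prod, Fintype.card_pi, ZMod.card, Finset.prod_const,
      Finset.card_univ, Fintype.card_fin, ← mul_pow]
    norm_num
  · push Not at hk
    rw [Finset.filter_false_of_mem]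
    · simp
    · rintro ω - ⟨h1, h2⟩
      apply hne
      funext k
      by_cases hkp : p ≤ k
      · exact hk k hkp
      · push Not at hkp
        have e1 := h1 ⟨k, hkp⟩
        have e2 := h2 ⟨k, hkp⟩
        have ek : Fin.castLE (hpq.trans (Nat.sub_le _ _)) ⟨(k : ℕ), hkp⟩ = k := Fin.ext rfl
        rw [ek] at e1 e2
        rw [e1, e2]
        congr 1
        apply Finset.sum_congr rfl
        intro j _
        rw [hk _ (show p ≤ p + (j : ℕ) by omega)]

/-! ### The second moment of the stochastic count of a random cell -/

open Classical in
-- With pair probabilities at most `a²` the off-diagonal terms are bounded by the squared mean. The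
-- diagonal and the sampling variance leave `a * ∑ (w² + v)`, at most twice the mean by `hwv`.
theorem sum_sq_indicator_le {Ω Z : Type} [Fintype Ω] [Fintype Z] (M : Ω → Z → Prop) (a : ℝ)
    (ha : 0 ≤ a) (w v : Z → ℝ) (hw : ∀ z, 0 ≤ w z) (hwv : ∀ z, w z ^ 2 + v z ≤ 2 * w z)
    (h1 : ∀ z, ((Finset.univ.filter fun ω => M ω z).card : ℝ) = Fintype.card Ω * a)
    (h2 : ∀ z z', z ≠ z' →
      ((Finset.univ.filter fun ω => M ω z ∧ M ω z').card : ℝ) ≤ Fintype.card Ω * a ^ 2) (s : ℝ) :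
    ∑ ω, ((∑ z, (if M ω z then w z else 0) - s) ^ 2 + ∑ z, if M ω z then v z else 0) ≤
      Fintype.card Ω * (((∑ z, w z) * a - s) ^ 2 + 2 * ((∑ z, w z) * a)) := by
  have hlin : ∀ u : Z → ℝ, ∑ ω, ∑ z, (if M ω z then u z else 0) =
      Fintype.card Ω * ((∑ z, u z) * a) := by
    intro u
    rw [Finset.sum_comm, Finset.sum_mul, Finset.mul_sum]
    apply Finset.sum_congr rfl
    intro z _
    rw [← Finset.sum_filter, Finset.sum_const, nsmul_eq_mul, h1]
    ring
  have hquad : ∑ ω, (∑ z, if M ω z then w z else 0) ^ 2 ≤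
      Fintype.card Ω * ((∑ z, w z) ^ 2 * a ^ 2 + (∑ z, w z ^ 2) * a) := by
    have e : ∀ ω, (∑ z, if M ω z then w z else 0) ^ 2 =
        ∑ z, ∑ z', if M ω z ∧ M ω z' then w z * w z' else 0 := by
      intro ω
      rw [sq, Finset.sum_mul_sum]
      apply Finset.sum_congr rfl
      intro z _
      apply Finset.sum_congr rfl
      intro z' _
      by_cases h : M ω z <;> by_cases h' : M ω z' <;> simp [h, h']
    simp_rw [e]
    rw [Finset.sum_comm]
    simp_rw [Finset.sum_comm (s := (Finset.univ : Finset Ω))]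
    have e2 : (Fintype.card Ω : ℝ) * ((∑ z, w z) ^ 2 * a ^ 2 + (∑ z, w z ^ 2) * a) =
        ∑ z, ∑ z', (Fintype.card Ω : ℝ) * (w z * w z' * a ^ 2 +
          if z = z' then w z ^ 2 * a else 0) := by
      simp_rw [← Finset.mul_sum, Finset.sum_add_distrib, Finset.sum_ite_eq]
      simp only [Finset.mem_univ, if_true]
      rw [sq (∑ z, w z), Finset.sum_mul_sum, Finset.sum_mul, Finset.sum_mul]
      simp_rw [Finset.sum_mul]
    rw [e2]
    apply Finset.sum_le_sum
    intro z _
    apply Finset.sum_le_sum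
    intro z' _
    rw [← Finset.sum_filter, Finset.sum_const, nsmul_eq_mul]
    have hww : 0 ≤ w z * w z' := mul_nonneg (hw z) (hw z')
    by_cases hzz : z = z'
    · subst hzz
      simp only [and_self, if_true]
      rw [h1]
      have : 0 ≤ (Fintype.card Ω : ℝ) * (w z * w z * a ^ 2) := by positivity
      linarith
    · rw [if_neg hzz, add_zero]
      calc _ ≤ (Fintype.card Ω * a ^ 2) * (w z * w z') :=
            mul_le_mul_of_nonneg_right (h2 z z' hzz) hww
        _ = _ := by ring
  have hexp : ∀ ω, ((∑ z, (if M ω z then w z else 0) - s) ^ 2 +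
      ∑ z, if M ω z then v z else 0) = (∑ z, if M ω z then w z else 0) ^ 2 -
        2 * s * (∑ z, if M ω z then w z else 0) + s ^ 2 + ∑ z, if M ω z then v z else 0 := by
    intro ω; ring
  simp_rw [hexp]
  rw [Finset.sum_add_distrib, Finset.sum_add_distrib, Finset.sum_sub_distrib, ← Finset.mul_sum,
    hlin w, hlin v, Finset.sum_const, Finset.card_univ, nsmul_eq_mul]
  have hsum : ∑ z, w z ^ 2 + ∑ z, v z ≤ 2 * ∑ z, w z := by
    rw [← Finset.sum_add_distrib, Finset.mul_sum]
    exact Finset.sum_le_sum fun z _ => hwv z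
  have hfin : (Fintype.card Ω : ℝ) * a * (∑ z, w z ^ 2 + ∑ z, v z) ≤
      Fintype.card Ω * a * (2 * ∑ z, w z) :=
    mul_le_mul_of_nonneg_left hsum (by positivity)
  nlinarith [hquad, hfin]

theorem weight_sq_add_weightVar_le {q : ℕ} (φ : DNF n m) (z : Fin q → ZMod 2) :
    weight φ z ^ 2 + weightVar φ z ≤ 2 * weight φ z := by
  unfold weight weightVar
  cases h : interpret φ z with
  | none => simp
  | some x =>
    obtain ⟨x, i⟩ := x
    simp only
    have hd : (1 : ℝ) ≤ degree φ x := Nat.one_le_cast.2 (degree_pos (sat_of_interpret h))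
    set d : ℝ := (degree φ x : ℝ)
    have hr : 0 ≤ d / m := by positivity
    have h1 : (1 / d) ^ 2 ≤ 1 / d := by
      rw [sq]
      exact mul_le_of_le_one_left (by positivity) (by rw [div_le_one (by linarith)]; exact hd)
    have h2 : (1 - d / m) / d ^ 2 ≤ (1 / d) ^ 2 := by
      rw [div_pow, one_pow]
      gcongr
      linarith
    linarith

/-- The bound on the failure probability of a stochastic count that comes from the second moment
about `s`. -/
theorem expect_prob_bsat_le [NeZero m] {q sI p : ℕ} (φ : DNF n m) (hsp : sI ≤ p)
    (hpq : p ≤ q - 1) (hq : 0 < q) (H s d : ℝ) (S : Set ℝ) (hd : 0 < d) (hH : 0 < H)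
    (hS : ∀ y ∈ S, 0 ≤ y → y < H → d ≤ |y - s|) (hSH : H ∈ S → s + d ≤ H) :
    (expect (sampleBase q sI) fun B => prob (bsat φ B H p) S) ≤
      ENNReal.ofReal ((d ^ 2)⁻¹ * (((∑ z : Fin q → ZMod 2, weight φ z) / 2 ^ p - s) ^ 2 +
        2 * ((∑ z : Fin q → ZMod 2, weight φ z) / 2 ^ p))) := by
  classical
  have hp : p ≤ q := hpq.trans (Nat.sub_le _ _)
  refine (expect_mono _ fun B => prob_bsat_le φ B H s d S hd hH hS hSH p hp).trans ?_
  rw [expect_sampleBase]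
  have hcard : (0 : ℝ) < Fintype.card (BaseSpace q sI) := Nat.cast_pos.2 Fintype.card_pos
  rw [← ENNReal.ofReal_sum_of_nonneg, ← ENNReal.ofReal_natCast (Fintype.card _),
    ← ENNReal.ofReal_inv_of_pos hcard, ← ENNReal.ofReal_mul (by positivity), ← Finset.mul_sum]
  · apply ENNReal.ofReal_le_ofReal
    have key := sum_sq_indicator_le (fun (ω : BaseSpace q sI) z => (extract ω.base p).Mem hp z)
      (1 / 2 ^ p) (by positivity) (weight φ) (weightVar φ) (weight_nonneg φ)
      (weight_sq_add_weightVar_le φ)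
      (by
        intro z
        have := card_mem_extract hsp hpq hq z
        rw [mul_one_div, eq_div_iff (by positivity)]
        exact_mod_cast this)
      (by
        intro z z' hne
        have := card_mem_mem_extract_le hsp hpq hne
        rw [div_pow, one_pow, ← pow_mul, mul_comm p 2, pow_mul, mul_one_div,
          le_div_iff₀ (by positivity)]
        rw [show (2 : ℝ) ^ 2 = 4 by norm_num]
        exact_mod_cast this) s
    simp only [mul_one_div] at key
    rw [mul_left_comm]
    apply mul_le_mul_of_nonneg_left _ (by positivity)
    rw [inv_mul_le_iff₀ hcard]
    exact key
  · intro ω _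
    apply mul_nonneg (by positivity)
    apply add_nonneg (sq_nonneg _)
    apply Finset.sum_nonneg
    intro z _
    split_ifs
    · exact weightVar_nonneg φ z
    · exact le_rfl

end SymbolicDNF

namespace SymbolicDNF

variable {n m : ℕ}

/-! ### The bit vectors count every solution once -/

/-- The number of variables before `v` that do not occur in the cube. -/
def freeRank (C : Cube n) (v : Fin n) : ℕ := (Finset.univ.filter fun u => u < v ∧ C u = none).card

theorem freeRank_lt {C : Cube n} {u v : Fin n} (h : u < v) (hu : C u = none) :
    freeRank C u < freeRank C v := by
  apply Finset.card_lt_card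
  rw [Finset.ssubset_iff_of_subset]
  · exact ⟨u, by simp [h, hu], by simp⟩
  · intro a
    simp only [Finset.mem_filter, Finset.mem_univ, true_and]
    exact fun ha => ⟨ha.1.trans h, ha.2⟩

theorem card_free (C : Cube n) :
    (Finset.univ.filter fun u => C u = none).card = n - C.width := by
  have := Finset.card_filter_add_card_filter_not (s := (Finset.univ : Finset (Fin n)))
    (fun u => C u = none)
  rw [Finset.card_univ, Fintype.card_fin] at this
  unfold Cube.width
  simp only [ne_eq]
  omega

theorem freeRank_lt_card {C : Cube n} {v : Fin n} (hv : C v = none) :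
    freeRank C v < n - C.width := by
  rw [← card_free]
  apply Finset.card_lt_card
  rw [Finset.ssubset_iff_of_subset]
  · exact ⟨v, by simp [hv], by simp⟩
  · intro a
    simp only [Finset.mem_filter, Finset.mem_univ, true_and]
    exact fun ha => ha.2

theorem freeRank_injective {C : Cube n} {u v : Fin n} (hu : C u = none) (hv : C v = none)
    (h : freeRank C u = freeRank C v) : u = v := by
  rcases lt_trichotomy u v with hlt | heq | hgt
  · exact absurd h (freeRank_lt hlt hu).ne
  · exact heq
  · exact absurd h (freeRank_lt hgt hv).ne'

theorem exists_freeRank_eq (C : Cube n) (i : Fin (n - C.width)) :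
    ∃ v, C v = none ∧ freeRank C v = i := by
  have := Finset.surj_on_of_inj_on_of_card_le (s := Finset.univ.filter fun u => C u = none)
    (t := (Finset.univ : Finset (Fin (n - C.width))))
    (fun v hv => ⟨freeRank C v, freeRank_lt_card (Finset.mem_filter.1 hv).2⟩)
    (fun _ _ => Finset.mem_univ _)
    (fun u v hu hv h => freeRank_injective (Finset.mem_filter.1 hu).2 (Finset.mem_filter.1 hv).2
      (congrArg Fin.val h))
    (by rw [card_free]; simp) i (Finset.mem_univ _)
  obtain ⟨v, hv, h⟩ := this
  exact ⟨v, (Finset.mem_filter.1 hv).2, (congrArg Fin.val h).symm⟩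

theorem complete_apply_of_none {C : Cube n} {v : Fin n} (hv : C v = none) (r : ℕ) :
    complete C r v = r.testBit (freeRank C v) := by
  simp [complete, hv, freeRank]

theorem complete_injective (C : Cube n) :
    Function.Injective fun r : Fin (2 ^ (n - C.width)) => complete C r := by
  intro r r' h
  apply Fin.ext
  apply Nat.eq_of_testBit_eq
  intro i
  by_cases hi : i < n - C.width
  · obtain ⟨v, hv, hr⟩ := exists_freeRank_eq C ⟨i, hi⟩
    have := congrFun h v
    simp only [complete_apply_of_none hv, hr] at this
    exact this
  · have hle : 2 ^ (n - C.width) ≤ 2 ^ i := Nat.pow_le_pow_right (by norm_num) (not_lt.1 hi)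
    rw [Nat.testBit_lt_two_pow (r.2.trans_le hle), Nat.testBit_lt_two_pow (r'.2.trans_le hle)]

theorem exists_complete_eq {C : Cube n} {x : Fin n → Bool} (hx : C.Sat x) :
    ∃ r : Fin (2 ^ (n - C.width)), complete C r = x := by
  choose v hv hr using exists_freeRank_eq C
  refine ⟨⟨Nat.ofBits fun i => x (v i), Nat.ofBits_lt_two_pow _⟩, ?_⟩
  funext u
  cases hu : C u with
  | none =>
    rw [complete_apply_of_none hu]
    simp only
    rw [Nat.testBit_ofBits_lt _ _ (freeRank_lt_card hu)]
    congr 1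
    exact freeRank_injective (hv _) hu (hr _)
  | some b =>
    rw [hx u b hu]
    simp [complete, hu]

open Classical in
theorem sum_complete (C : Cube n) (g : (Fin n → Bool) → ℝ) :
    ∑ r : Fin (2 ^ (n - C.width)), g (complete C r) =
      ∑ x, if C.Sat x then g x else 0 := by
  rw [← Finset.sum_filter]
  refine Finset.sum_bij (fun r _ => complete C r) ?_ ?_ ?_ ?_
  · intro r _
    simpa using complete_sat C r
  · intro r _ r' _ h
    exact complete_injective C h
  · intro x hx
    obtain ⟨r, hr⟩ := exists_complete_eq (Finset.mem_filter.1 hx).2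
    exact ⟨r, Finset.mem_univ _, hr⟩
  · intro r _
    rfl

theorem sum_bitsToNat {q N : ℕ} (hN : N ≤ 2 ^ q) (g : Fin N → ℝ) :
    ∑ z : Fin q → ZMod 2, (if h : bitsToNat z < N then g ⟨bitsToNat z, h⟩ else 0) =
      ∑ a, g a := by
  have h1 : ∑ z : Fin q → ZMod 2, (if h : bitsToNat z < N then g ⟨bitsToNat z, h⟩ else 0) =
      ∑ a : Fin (2 ^ q), if h : (a : ℕ) < N then g ⟨a, h⟩ else 0 := by
    refine Fintype.sum_equiv (finFunctionFinEquiv (m := 2) (n := q)) _ _ ?_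
    intro z
    have : bitsToNat z = (finFunctionFinEquiv (m := 2) (n := q) z : ℕ) := by
      rw [finFunctionFinEquiv_apply]
      rfl
    simp only [this]
  rw [h1, Fin.sum_univ_eq_sum_range (fun a => if h : a < N then g ⟨a, h⟩ else 0),
    ← Finset.sum_subset (Finset.range_subset_range.2 hN), ← Fin.sum_univ_eq_sum_range
    (fun a => if h : a < N then g ⟨a, h⟩ else 0)]
  · apply Finset.sum_congr rfl
    intro a _
    rw [dif_pos a.2]
  · intro a _ ha
    rw [dif_neg (by simpa using ha)]

/-- Double counting: a solution occurs in one pair for each cube that it satisfies, and each of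
these pairs has weight `1 / degree`. -/
theorem sum_weight (φ : DNF n m) :
    ∑ z : Fin (numBits φ) → ZMod 2, weight φ z = (solutions φ).ncard := by
  classical
  obtain ⟨g, hg⟩ : ∃ g : Fin (numPairs φ) → ℝ, g = fun a =>
      let s : (i : Fin m) × Fin (2 ^ (n - (φ i).width)) := finSigmaFinEquiv.symm a
      1 / (degree φ (complete (φ s.1) s.2) : ℝ) := ⟨_, rfl⟩
  have hw : ∀ z : Fin (numBits φ) → ZMod 2, weight φ z =
      if h : bitsToNat z < numPairs φ then g ⟨bitsToNat z, h⟩ else 0 := by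
    intro z
    rw [hg]
    unfold weight interpret
    by_cases h : bitsToNat z < numPairs φ
    · simp only [dif_pos h]
      rfl
    · simp only [dif_neg h]
  rw [Finset.sum_congr rfl fun z _ => hw z,
    sum_bitsToNat (q := numBits φ) (Nat.le_pow_clog (by norm_num) (numPairs φ)) g]
  have h2 : ∑ a, g a = ∑ s : (i : Fin m) × Fin (2 ^ (n - (φ i).width)),
      1 / (degree φ (complete (φ s.1) s.2) : ℝ) := by
    rw [hg]
    exact Fintype.sum_equiv finSigmaFinEquiv.symm _ _ fun _ => rfl
  rw [h2, Fintype.sum_sigma]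
  simp only
  simp_rw [sum_complete (φ _) (fun x => 1 / (degree φ x : ℝ))]
  rw [Finset.sum_comm]
  have h3 : ∀ x, ∑ i, (if (φ i).Sat x then 1 / (degree φ x : ℝ) else 0) =
      if x ∈ solutions φ then 1 else 0 := by
    intro x
    rw [← Finset.sum_filter, Finset.sum_const, nsmul_eq_mul]
    change (degree φ x : ℝ) * _ = _
    by_cases h : x ∈ solutions φ
    · obtain ⟨i, hi⟩ := h
      have : (degree φ x : ℝ) ≠ 0 := by exact_mod_cast (degree_pos hi).ne'
      rw [if_pos ⟨i, hi⟩]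
      field_simp
    · have : degree φ x = 0 := by
        by_contra hne
        obtain ⟨i, hi⟩ := Finset.card_pos.1 (Nat.pos_of_ne_zero hne)
        exact h ⟨i, (Finset.mem_filter.1 hi).2⟩
      rw [if_neg h, this]
      simp
  simp_rw [h3]
  rw [Finset.sum_boole, Set.ncard_eq_toFinset_card']
  congr 2
  ext x
  simp

theorem weight_le_one {q : ℕ} (φ : DNF n m) (z : Fin q → ZMod 2) : weight φ z ≤ 1 := by
  unfold weight
  cases h : interpret φ z with
  | none => simp
  | some x =>
    have hd : (1 : ℝ) ≤ degree φ x.1 := Nat.one_le_cast.2 (degree_pos (sat_of_interpret h))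
    exact (div_le_one (by linarith)).2 hd

theorem ncard_solutions_le (φ : DNF n m) : ((solutions φ).ncard : ℝ) ≤ 2 ^ numBits φ := by
  rw [← sum_weight]
  refine (Finset.sum_le_sum fun z _ => weight_le_one φ z).trans_eq ?_
  simp [ZMod.card]

theorem two_pow_le_ncard_solutions [NeZero m] (φ : DNF n m) :
    2 ^ (n - cubeWidth φ) ≤ (solutions φ).ncard := by
  obtain ⟨i, hi⟩ := ciInf_mem fun i => (φ i).width
  rw [cubeWidth, ← hi]
  have h := Set.ncard_le_ncard (s := Set.range fun r : Fin (2 ^ (n - (φ i).width)) =>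
    complete (φ i) r) (t := solutions φ) (by
      rintro _ ⟨r, rfl⟩
      exact ⟨i, complete_sat _ _⟩) (Set.toFinite _)
  rwa [← Set.image_univ, Set.ncard_image_of_injective _ (complete_injective _), Set.ncard_univ,
    Nat.card_fin] at h

theorem cubeWidth_le [NeZero m] (φ : DNF n m) : cubeWidth φ ≤ n := by
  obtain ⟨i, hi⟩ := ciInf_mem fun i => (φ i).width
  rw [cubeWidth, ← hi]
  exact (Finset.card_filter_le _ _).trans_eq (by simp)

end SymbolicDNF

namespace SymbolicDNF

open scoped ENNReal

variable {n m : ℕ} [NeZero m]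

/-! ### Tail bounds for the stochastic count of a random cell -/

/-- The expected stochastic count of a cell with `p` constraints. -/
noncomputable def meanCount (φ : DNF n m) (p : ℕ) : ℝ := (solutions φ).ncard / 2 ^ p

/-- The probability that the stochastic count of a random cell with `p` constraints lies in `S`. -/
noncomputable def cellProb (φ : DNF n m) (H : ℝ) (p : ℕ) (S : Set ℝ) : ℝ≥0∞ :=
  expect (sampleBase (numBits φ) ⌊startIndex φ H⌋₊) fun B => prob (bsat φ B H p) S

section Tail

variable {φ : DNF n m} {H : ℝ} {p : ℕ}

theorem cellProb_le_of_moment (hsp : ⌊startIndex φ H⌋₊ ≤ p) (hpq : p < numBits φ)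
    (s d : ℝ) (S : Set ℝ) (hd : 0 < d) (hH : 0 < H)
    (hS : ∀ y ∈ S, 0 ≤ y → y < H → d ≤ |y - s|) (hSH : H ∈ S → s + d ≤ H) :
    cellProb φ H p S ≤
      ENNReal.ofReal (((meanCount φ p - s) ^ 2 + 2 * meanCount φ p) / d ^ 2) := by
  have := expect_prob_bsat_le φ hsp (Nat.le_sub_one_of_lt hpq) (by omega) H s d S hd hH hS hSH
  rw [sum_weight, inv_mul_eq_div] at this
  exact this

theorem cellProb_le_chebyshev (hsp : ⌊startIndex φ H⌋₊ ≤ p) (hpq : p < numBits φ)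
    (d : ℝ) (S : Set ℝ) (hd : 0 < d) (hH : 0 < H)
    (hS : ∀ y ∈ S, 0 ≤ y → y < H → d ≤ |y - meanCount φ p|)
    (hSH : H ∈ S → meanCount φ p + d ≤ H) :
    cellProb φ H p S ≤ ENNReal.ofReal (2 * meanCount φ p / d ^ 2) := by
  simpa using cellProb_le_of_moment hsp hpq _ d S hd hH hS hSH

/-- Cantelli's bound with variance `2μ`, obtained from the moment about the optimal centre `s = μ +
2μ/α` with `d = α + 2μ/α`. The same moment covers the upper tail from `s + d = μ + α + 4μ/α` on at
no extra cost. -/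
theorem cellProb_le_cantelli (hsp : ⌊startIndex φ H⌋₊ ≤ p) (hpq : p < numBits φ)
    (α : ℝ) (S : Set ℝ) (hα : 0 < α) (hμ : 0 < meanCount φ p) (hH : 0 < H)
    (hS : ∀ y ∈ S, 0 ≤ y → y < H →
      y < meanCount φ p - α ∨ meanCount φ p + α + 4 * meanCount φ p / α ≤ y)
    (hSH : H ∈ S → meanCount φ p + α + 4 * meanCount φ p / α ≤ H) :
    cellProb φ H p S ≤
      ENNReal.ofReal (2 * meanCount φ p / (2 * meanCount φ p + α ^ 2)) := by
  set μ := meanCount φ p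
  have h4 : 4 * μ / α = 2 * (2 * μ / α) := by ring
  have hβ : 0 < 2 * μ / α := by positivity
  have hd : 0 < α + 2 * μ / α := by positivity
  refine (cellProb_le_of_moment hsp hpq (μ + 2 * μ / α) (α + 2 * μ / α) S hd hH ?_ ?_).trans
    (le_of_eq ?_)
  · intro y hy h0 hyH
    rcases hS y hy h0 hyH with h | h
    · rw [abs_of_neg (by linarith)]
      linarith
    · rw [abs_of_nonneg (by linarith)]
      linarith
  · intro h
    linarith [hSH h]
  · congr 1
    change ((μ - (μ + 2 * μ / α)) ^ 2 + 2 * μ) / _ = _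
    field_simp
    ring

theorem cellProb_Iio_le (hsp : ⌊startIndex φ H⌋₊ ≤ p) (hpq : p < numBits φ) (hH : 0 < H)
    (hμ : H < meanCount φ p) : cellProb φ H p (Set.Iio H) ≤
      ENNReal.ofReal (2 * meanCount φ p / (meanCount φ p - H) ^ 2) := by
  refine cellProb_le_chebyshev hsp hpq _ _ (by linarith) hH ?_ ?_
  · intro y _ _ hy
    rw [abs_of_neg (by linarith)]
    linarith
  · intro h
    exact absurd h (lt_irrefl H)

theorem cellProb_Ici_le (hsp : ⌊startIndex φ H⌋₊ ≤ p) (hpq : p < numBits φ) (hH : 0 < H)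
    (hμ : meanCount φ p < H) : cellProb φ H p (Set.Ici H) ≤
      ENNReal.ofReal (2 * meanCount φ p / (H - meanCount φ p) ^ 2) := by
  refine cellProb_le_chebyshev hsp hpq _ _ (by linarith) hH ?_ ?_
  · intro y hy _ hyH
    exact absurd hyH (not_lt.2 hy)
  · intro _
    linarith

end Tail

/-! ### Summation of error terms over dyadic scales -/

theorem sum_two_pow_le (p : ℕ) : ∑ k ∈ Finset.range p, (2 : ℝ) ^ k ≤ 2 ^ p := by
  rw [geom_sum_eq (by norm_num)]
  norm_num

theorem sum_Ioo_two_pow_div_le (p u : ℕ) (h : p < u) :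
    ∑ k ∈ Finset.Ico (p + 1) u, (2 : ℝ) ^ p / 2 ^ k ≤ 1 - 2 ^ p / 2 ^ (u - 1) := by
  induction u, h using Nat.le_induction with
  | base => simp
  | succ u hu ih =>
    rw [Finset.sum_Ico_succ_top hu]
    obtain ⟨v, rfl⟩ : ∃ v, u = v + 1 := ⟨u - 1, by omega⟩
    simp only [Nat.add_sub_cancel] at ih ⊢
    have : (2 : ℝ) ^ p / 2 ^ v = 2 * (2 ^ p / 2 ^ (v + 1)) := by
      rw [pow_succ]; field_simp
    linarith

/-- The three terms just below `p` are kept apart because the geometric bound is too weak there. The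
factor `1/8` bounds the sum of `2^(k-p)` over `k ≤ p - 4`; the sum above `p` is at most `1`. -/
theorem sum_range_le_of_dyadic (e : ℕ → ℝ≥0∞) (p u : ℕ) (hu : p < u) (C c₃ c₂ c₁ c₀ U : ℝ)
    (hC : 0 ≤ C) (hc₃ : 0 ≤ c₃) (hc₂ : 0 ≤ c₂) (hc₁ : 0 ≤ c₁) (hc₀ : 0 ≤ c₀) (hU : 0 ≤ U)
    (h4 : ∀ k, k + 4 ≤ p → e k ≤ ENNReal.ofReal (C * (2 ^ k / 2 ^ p)))
    (h3 : ∀ k, k + 3 = p → e k ≤ ENNReal.ofReal c₃)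
    (h2 : ∀ k, k + 2 = p → e k ≤ ENNReal.ofReal c₂)
    (h1 : ∀ k, k + 1 = p → e k ≤ ENNReal.ofReal c₁)
    (h0 : e p ≤ ENNReal.ofReal c₀)
    (hhi : ∀ k, p < k → k < u → e k ≤ ENNReal.ofReal (U * (2 ^ p / 2 ^ k))) :
    ∑ k ∈ Finset.range u, e k ≤ ENNReal.ofReal (C / 8 + c₃ + c₂ + c₁ + c₀ + U) := by
  rw [← Finset.sum_range_add_sum_Ico _ (show p + 1 ≤ u from hu), Finset.sum_range_succ]
  have hup : ∑ k ∈ Finset.Ico (p + 1) u, e k ≤ ENNReal.ofReal U := by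
    calc _ ≤ ∑ k ∈ Finset.Ico (p + 1) u, ENNReal.ofReal (U * (2 ^ p / 2 ^ k)) := by
          refine Finset.sum_le_sum fun k hk => ?_
          rw [Finset.mem_Ico] at hk
          exact hhi k (by omega) hk.2
      _ = ENNReal.ofReal (U * ∑ k ∈ Finset.Ico (p + 1) u, (2 : ℝ) ^ p / 2 ^ k) := by
          rw [Finset.mul_sum, ENNReal.ofReal_sum_of_nonneg]
          intro k _
          positivity
      _ ≤ _ := by
          apply ENNReal.ofReal_le_ofReal
          have h1 := sum_Ioo_two_pow_div_le p u hu
          have h2 : (0 : ℝ) ≤ 2 ^ p / 2 ^ (u - 1) := by positivity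
          exact mul_le_of_le_one_right hU (by linarith)
  have hlow : ∑ k ∈ Finset.range p, e k ≤ ENNReal.ofReal (C / 8 + c₃ + c₂ + c₁) := by
    rcases p with _ | _ | _ | p
    · simp
    · simp only [zero_add, Finset.sum_range_one]
      exact (h1 0 rfl).trans (ENNReal.ofReal_le_ofReal (by linarith))
    · simp only [zero_add, Nat.reduceAdd, Finset.sum_range_succ, Finset.range_zero,
        Finset.sum_empty]
      refine (add_le_add (h2 0 rfl) (h1 1 rfl)).trans ?_
      rw [← ENNReal.ofReal_add hc₂ hc₁]
      exact ENNReal.ofReal_le_ofReal (by linarith)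
    · rw [Finset.sum_range_succ, Finset.sum_range_succ, Finset.sum_range_succ]
      rw [ENNReal.ofReal_add (by positivity) hc₁, ENNReal.ofReal_add (by positivity) hc₂,
        ENNReal.ofReal_add (by positivity) hc₃]
      refine add_le_add (add_le_add (add_le_add ?_ (h3 p rfl)) (h2 (p + 1) rfl)) (h1 (p + 2) rfl)
      calc _ ≤ ∑ k ∈ Finset.range p, ENNReal.ofReal (C * (2 ^ k / 2 ^ (p + 1 + 1 + 1))) := by
            refine Finset.sum_le_sum fun k hk => h4 k ?_
            rw [Finset.mem_range] at hk
            omega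
        _ = ENNReal.ofReal (C / 8 / 2 ^ p * ∑ k ∈ Finset.range p, (2 : ℝ) ^ k) := by
            rw [Finset.mul_sum, ENNReal.ofReal_sum_of_nonneg]
            · apply Finset.sum_congr rfl
              intro k _
              congr 1
              rw [pow_succ, pow_succ, pow_succ]
              field_simp
              norm_num
            · intro k _
              positivity
        _ ≤ _ := by
            apply ENNReal.ofReal_le_ofReal
            rw [div_mul_eq_mul_div, div_le_iff₀ (by positivity)]
            exact mul_le_mul_of_nonneg_left (sum_two_pow_le p) (by positivity)
  refine (add_le_add (add_le_add hlow h0) hup).trans ?_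
  rw [ENNReal.ofReal_add (by positivity) hU, ENNReal.ofReal_add (by positivity) hc₀]

/-! ### Numerical estimates -/

theorem inv_one_add_mul_le_chord {c t : ℝ} (hc : 0 ≤ c) (h1 : 1 ≤ t) (h2 : t ≤ 2) :
    1 / (1 + c * t) ≤ (2 - t) * (1 / (1 + c)) + (t - 1) * (1 / (1 + 2 * c)) := by
  have e : (2 - t) * (1 / (1 + c)) + (t - 1) * (1 / (1 + 2 * c)) - 1 / (1 + c * t) =
      2 * c ^ 2 * ((t - 1) * (2 - t)) * (1 / ((1 + c) * (1 + 2 * c) * (1 + c * t))) / 2 := by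
    have : 0 < 1 + c * t := by nlinarith
    field_simp
    ring
  have : 0 ≤ 2 * c ^ 2 * ((t - 1) * (2 - t)) * (1 / ((1 + c) * (1 + 2 * c) * (1 + c * t))) / 2 := by
    have h3 : 0 ≤ (t - 1) * (2 - t) := mul_nonneg (by linarith) (by linarith)
    have h4 : 0 < 1 + c * t := by nlinarith
    positivity
  linarith

theorem low_term_le {a A x h H : ℝ} (hA : 0 < A) (haA : A ≤ a) (hH : H ≤ h * a) (hh : 0 < h)
    (hx : h < x) : 2 * (x * a) / (x * a - H) ^ 2 ≤ 2 * x / (A * (x - h) ^ 2) := by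
  have ha : 0 < a := hA.trans_le haA
  have h1 : 0 < (x - h) * a := mul_pos (by linarith) ha
  have hx0 : 0 < x := by linarith
  calc 2 * (x * a) / (x * a - H) ^ 2 ≤ 2 * (x * a) / ((x - h) * a) ^ 2 := by
        gcongr
        linarith
    _ = 2 * x / (a * (x - h) ^ 2) := by
        have : x - h ≠ 0 := by linarith
        field_simp
    _ ≤ _ := by
        have : 0 < x - h := by linarith
        gcongr

theorem low_term_le_inv {A x h r : ℝ} (hA : 0 < A) (hr : 0 < r)
    (hx : h ≤ (1 - r) * x) (hx0 : 0 < x) :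
    2 * x / (A * (x - h) ^ 2) ≤ 2 / (A * r ^ 2) / x := by
  have h1 : r * x ≤ x - h := by linarith
  calc 2 * x / (A * (x - h) ^ 2) ≤ 2 * x / (A * (r * x) ^ 2) := by gcongr
    _ = _ := by field_simp

/-- For `x ≤ 2` the quotient `κ / (2 + 2κ - x)` increases with `κ`, so the largest admissible value
`K` may be inserted. -/
theorem high_term_le {κ K x a H : ℝ} (hκ : 0 < κ) (hκK : κ ≤ K) (hx : 0 < x) (hx2 : x ≤ 2)
    (ha : a = 9.84 / κ ^ 2) (hH : (2 + 2 * κ) * a ≤ H) :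
    2 * (x * a) / (H - x * a) ^ 2 ≤ K ^ 2 / 4.92 * x / (2 + 2 * K - x) ^ 2 := by
  have ha0 : 0 < a := by rw [ha]; positivity
  have h1 : 0 < 2 + 2 * κ - x := by linarith
  have h2 : 0 < 2 + 2 * K - x := by linarith
  have h3 : κ / (2 + 2 * κ - x) ≤ K / (2 + 2 * K - x) := by
    rw [div_le_div_iff₀ h1 h2]
    nlinarith
  calc 2 * (x * a) / (H - x * a) ^ 2 ≤ 2 * (x * a) / ((2 + 2 * κ - x) * a) ^ 2 := by
        gcongr
        linarith
    _ = (κ / (2 + 2 * κ - x)) ^ 2 * x / 4.92 := by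
        rw [ha]
        field_simp
        norm_num
    _ ≤ (K / (2 + 2 * K - x)) ^ 2 * x / 4.92 := by gcongr
    _ = _ := by rw [div_pow]; field_simp

theorem high_term_tail_le {K x t : ℝ} (hK : 0 ≤ K) (hx : 0 < x) (hxt : x ≤ t / 2)
    (ht : t ≤ 2) :
    K ^ 2 / 4.92 * x / (2 + 2 * K - x) ^ 2 ≤ K ^ 2 / 4.92 * x / (2 + 2 * K - t / 2) ^ 2 := by
  have : 0 < 2 + 2 * K - t / 2 := by linarith
  gcongr

theorem chord_inv {t : ℝ} (h1 : 1 ≤ t) (h2 : t ≤ 2) : 1 / t ≤ (3 - t) / 2 := by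
  rw [div_le_div_iff₀ (by linarith) (by norm_num)]
  nlinarith [mul_nonneg (sub_nonneg.2 h1) (sub_nonneg.2 h2)]

/-- The summands belong to `k ≤ p₀ - 4`, `p₀ - 3`, `p₀ - 2`, `p₀ - 1`, `p₀` and `k > p₀`. Each is
bounded on `[1, 2]` by an affine function of `t`, which makes the final inequality linear. -/
theorem total_error_le_of_large {t : ℝ} (h1 : 1 ≤ t) (h2 : t ≤ 2) :
    2 / (39.36 * 0.809 ^ 2) / t / 8 + 2 * (8 * t) / (39.36 * (8 * t - 3.051) ^ 2)
      + 1 / (1 + 19.68 * t) + 1 / (1 + 9.84 * t)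
      + (0.5 ^ 2 / 4.92 * t / (2 + 2 * 0.5 - t) ^ 2 + 1 / (1 + 4.92 * t))
      + 0.5 ^ 2 / 4.92 * t / (2 + 2 * 0.5 - t / 2) ^ 2 ≤ 0.36 := by
  have hp : 0 ≤ (t - 1) * (2 - t) := mul_nonneg (by linarith) (by linarith)
  have b1 := inv_one_add_mul_le_chord (c := 19.68) (by norm_num) h1 h2
  have b2 := inv_one_add_mul_le_chord (c := 9.84) (by norm_num) h1 h2
  have b3 := inv_one_add_mul_le_chord (c := 4.92) (by norm_num) h1 h2
  have b4 : 2 / (39.36 * 0.809 ^ 2) / t / 8 ≤ 0.00972 * ((3 - t) / 2) := by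
    have := chord_inv h1 h2
    calc 2 / (39.36 * 0.809 ^ 2) / t / 8 = 2 / (39.36 * 0.809 ^ 2) / 8 * (1 / t) := by ring
      _ ≤ 0.00972 * ((3 - t) / 2) := by gcongr; norm_num
  have b5 : 2 * (8 * t) / (39.36 * (8 * t - 3.051) ^ 2) ≤ 0.0167 + (t - 1) * (-0.009) := by
    rw [div_le_iff₀ (by nlinarith)]
    nlinarith [mul_nonneg hp (sub_nonneg.2 h1), mul_nonneg hp (sub_nonneg.2 h2)]
  have b6 : 0.5 ^ 2 / 4.92 * t / (2 + 2 * 0.5 - t) ^ 2 ≤ 0.01271 + (t - 1) * 0.08895 := by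
    rw [div_le_iff₀ (by nlinarith)]
    nlinarith [mul_nonneg hp (sub_nonneg.2 h1), mul_nonneg hp (sub_nonneg.2 h2)]
  have b7 : 0.5 ^ 2 / 4.92 * t / (2 + 2 * 0.5 - t / 2) ^ 2 ≤ 0.00815 + (t - 1) * 0.0174 := by
    rw [div_le_iff₀ (by nlinarith)]
    nlinarith [mul_nonneg hp (sub_nonneg.2 h1), mul_nonneg hp (sub_nonneg.2 h2)]
  norm_num at b1 b2 b3 b4 b5 b6 b7 ⊢
  linarith

theorem total_error_le_of_small {t : ℝ} (h1 : 1 ≤ t) (h2 : t ≤ 2) :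
    2 / (117 * 0.837 ^ 2) / t / 8 + 2 * (8 * t) / (117 * (8 * t - 2.598) ^ 2)
      + 2 * (4 * t) / (117 * (4 * t - 2.598) ^ 2) + 1 / (1 + 9.84 * t)
      + (0.29 ^ 2 / 4.92 * t / (2 + 2 * 0.29 - t) ^ 2 + 1 / (4.92 * t))
      + 0.29 ^ 2 / 4.92 * t / (2 + 2 * 0.29 - t / 2) ^ 2 ≤ 0.36 := by
  have hp : 0 ≤ (t - 1) * (2 - t) := mul_nonneg (by linarith) (by linarith)
  have b2 := inv_one_add_mul_le_chord (c := 9.84) (by norm_num) h1 h2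
  have b3 : 1 / (4.92 * t) ≤ 0.20326 * ((3 - t) / 2) := by
    have := chord_inv h1 h2
    calc 1 / (4.92 * t) = 1 / 4.92 * (1 / t) := by field_simp
      _ ≤ _ := by gcongr; norm_num
  have b4 : 2 / (117 * 0.837 ^ 2) / t / 8 ≤ 0.0031 * ((3 - t) / 2) := by
    have := chord_inv h1 h2
    calc 2 / (117 * 0.837 ^ 2) / t / 8 = 2 / (117 * 0.837 ^ 2) / 8 * (1 / t) := by ring
      _ ≤ _ := by gcongr; norm_num
  have b5 : 2 * (8 * t) / (117 * (8 * t - 2.598) ^ 2) ≤ 0.0048 + (t - 1) * (-0.002) := by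
    rw [div_le_iff₀ (by nlinarith)]
    nlinarith [mul_nonneg hp (sub_nonneg.2 h1), mul_nonneg hp (sub_nonneg.2 h2)]
  have b8 : 2 * (4 * t) / (117 * (4 * t - 2.598) ^ 2) ≤ 0.0349 + (t - 1) * (-0.02) := by
    rw [div_le_iff₀ (by nlinarith)]
    nlinarith [mul_nonneg hp (sub_nonneg.2 h1), mul_nonneg hp (sub_nonneg.2 h2)]
  have b6 : 0.29 ^ 2 / 4.92 * t / (2 + 2 * 0.29 - t) ^ 2 ≤ 0.00685 + (t - 1) * 0.0951 := by
    rw [div_le_iff₀ (by nlinarith)]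
    nlinarith [mul_nonneg hp (sub_nonneg.2 h1), mul_nonneg hp (sub_nonneg.2 h2)]
  have b7 : 0.29 ^ 2 / 4.92 * t / (2 + 2 * 0.29 - t / 2) ^ 2 ≤ 0.00396 + (t - 1) * 0.0098 := by
    rw [div_le_iff₀ (by nlinarith)]
    nlinarith [mul_nonneg hp (sub_nonneg.2 h1), mul_nonneg hp (sub_nonneg.2 h2)]
  norm_num at b2 b3 b4 b5 b6 b7 b8 ⊢
  linarith

end SymbolicDNF

namespace SymbolicDNF

open scoped ENNReal

variable {n m : ℕ} [NeZero m]

/-! ### The failure probability of the core algorithm -/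

theorem hiThresh_mul_two_pow_le (φ : DNF n m) {H : ℝ} (hH : 0 < H) (hstart : 0 ≤ startIndex φ H) :
    H * 2 ^ ⌊startIndex φ H⌋₊ ≤ ((solutions φ).ncard : ℝ) := by
  have h1 : ((2 : ℝ) ^ (n - cubeWidth φ) : ℝ) ≤ (solutions φ).ncard := by
    exact_mod_cast two_pow_le_ncard_solutions φ
  refine le_trans ?_ h1
  have h2 : (2 : ℝ) ^ ⌊startIndex φ H⌋₊ ≤ 2 ^ (startIndex φ H) := by
    rw [← Real.rpow_natCast]
    exact Real.rpow_le_rpow_of_exponent_le (by norm_num) (Nat.floor_le hstart)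
  have h3 : (2 : ℝ) ^ (startIndex φ H) = 2 ^ (n - cubeWidth φ) / H := by
    rw [startIndex, Real.rpow_sub (by norm_num), Real.rpow_logb (by norm_num) (by norm_num) hH,
      ← Nat.cast_sub (cubeWidth_le φ), Real.rpow_natCast]
  rw [h3, le_div_iff₀ hH] at h2
  linarith

theorem cellProb_stepError_low_le {φ : DNF n m} {H : ℝ} (f : Base (numBits φ) ⌊startIndex φ H⌋₊ →
    ℕ → ℝ≥0∞) (hf : ∀ B k, f B k ≤ 1) {p₀ k : ℕ} (hk : k < p₀) :
    (expect (sampleBase (numBits φ) ⌊startIndex φ H⌋₊) fun B => stepError φ B H (f B) p₀ k) ≤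
      min (cellProb φ H k (Set.Iio H))
        (expect (sampleBase (numBits φ) ⌊startIndex φ H⌋₊) fun B => f B k) := by
  apply le_min
  · refine expect_mono _ fun B => ?_
    rw [stepError, if_pos hk]
    exact mul_le_of_le_one_right' (hf B k)
  · refine expect_mono _ fun B => ?_
    rw [stepError, if_pos hk]
    exact mul_le_of_le_one_left' (prob_le_one _ _)

theorem mem_compl_Icc_iff {N ε κ y : ℝ} (hκ : 1 / (1 + ε) = 1 - κ) (p : ℕ) :
    y * 2 ^ p ∈ (Set.Icc (N / (1 + ε)) ((1 + ε) * N))ᶜ ↔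
      y < N / 2 ^ p - κ * (N / 2 ^ p) ∨ (1 + ε) * (N / 2 ^ p) < y := by
  rw [Set.mem_compl_iff, Set.mem_Icc, not_and_or, not_le, not_le]
  have h2 : (0 : ℝ) < 2 ^ p := by positivity
  rw [show N / (1 + ε) = (N / 2 ^ p - κ * (N / 2 ^ p)) * 2 ^ p by
      rw [div_eq_mul_one_div N, hκ]; field_simp,
    show (1 + ε) * N = (1 + ε) * (N / 2 ^ p) * 2 ^ p by field_simp,
    mul_lt_mul_iff_left₀ h2, mul_lt_mul_iff_left₀ h2]

/-- The parameters of the analysis of the core algorithm: `κ = ε / (1 + ε)`, the scale `a` of the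
threshold `H`, and the critical number `p₀` of constraints, for which the mean count is `t * a`. -/
structure CriticalParams (φ : DNF n m) (ε κ a H t : ℝ) (p₀ : ℕ) : Prop where
  eps_pos : 0 < ε
  kappa_pos : 0 < κ
  kappa_le : κ ≤ 0.5
  one_div_eq : 1 / (1 + ε) = 1 - κ
  eps_sub : ε - κ = ε * κ
  scale_eq : a = 9.84 / κ ^ 2
  thresh_eq : H = 2 + (2 + 2 * κ) * a
  le_scale : 39.36 ≤ a
  start_lt : ⌊startIndex φ H⌋₊ < p₀
  lt_numBits : p₀ < numBits φ - 1
  one_le : 1 ≤ t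
  le_two : t ≤ 2
  mean_eq : ((solutions φ).ncard : ℝ) = t * a * 2 ^ p₀

theorem exists_criticalParams (φ : DNF n m) (ε : ℝ) (hε : 0 < ε) (hε1 : ε < 1)
    (hstart : 0 ≤ startIndex φ (hiThresh ε)) :
    ∃ κ a t p₀, CriticalParams φ ε κ a (hiThresh ε) t p₀ := by
  obtain ⟨κ, hκdef⟩ : ∃ κ, κ = ε / (1 + ε) := ⟨_, rfl⟩
  have hκ0 : 0 < κ := by rw [hκdef]; positivity
  have hκ1 : κ ≤ 0.5 := by rw [hκdef, div_le_iff₀ (by linarith)]; linarith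
  have hκinv : 1 / (1 + ε) = 1 - κ := by rw [hκdef]; field_simp; ring
  have hεκ : ε - κ = ε * κ := by rw [hκdef]; field_simp; ring
  obtain ⟨a, ha⟩ : ∃ a, a = 9.84 / κ ^ 2 := ⟨_, rfl⟩
  have ha0 : 0 < a := by rw [ha]; positivity
  have hκa : κ ^ 2 * a = 9.84 := by rw [ha]; field_simp
  obtain ⟨H, hHdef⟩ : ∃ H, H = hiThresh ε := ⟨_, rfl⟩
  have hH : H = 2 + (2 + 2 * κ) * a := by
    have h1 : (1 + 1 / ε) ^ 2 = 1 / κ ^ 2 := by rw [hκdef]; field_simp; ring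
    rw [hHdef, hiThresh, h1, ← hκdef, ha]
    ring
  have ha39 : 39.36 ≤ a := by
    rw [ha, le_div_iff₀ (by positivity)]
    nlinarith
  have hκap : 0 < κ * a := by positivity
  have hH0 : 0 < H := by rw [hH]; positivity
  have hHa : 2 * a < H := by rw [hH]; nlinarith
  rw [← hHdef] at hstart ⊢
  set N : ℝ := ((solutions φ).ncard : ℝ) with hN
  have hsN : H * 2 ^ ⌊startIndex φ H⌋₊ ≤ N := hiThresh_mul_two_pow_le φ hH0 hstart
  have hNa : 2 * a < N := by
    have : (1 : ℝ) ≤ 2 ^ ⌊startIndex φ H⌋₊ := one_le_pow₀ (by norm_num)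
    nlinarith
  -- The mean at `p₀` lies in `[a, 2a)`. At the start index it is at least `H > 2a`, so `p₀` is
  -- larger; and `N ≤ 2 ^ numBits φ` with `a > 4` keeps `p₀` below the untested upper end.
  obtain ⟨p₀, hp1, hp2⟩ := exists_nat_pow_near (x := N / a) (y := (2 : ℝ))
    (by rw [le_div_iff₀ ha0]; linarith) (by norm_num)
  rw [le_div_iff₀ ha0] at hp1
  rw [div_lt_iff₀ ha0, pow_succ] at hp2
  have hl : ⌊startIndex φ H⌋₊ < p₀ := by
    by_contra hcon
    have h1 : (2 : ℝ) ^ p₀ ≤ 2 ^ ⌊startIndex φ H⌋₊ :=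
      pow_le_pow_right₀ (by norm_num) (not_lt.1 hcon)
    have h2 : H * 2 ^ p₀ ≤ H * 2 ^ ⌊startIndex φ H⌋₊ := by gcongr
    have h3 : (2 * a) * 2 ^ p₀ ≤ H * 2 ^ p₀ := by gcongr
    linarith
  have hu : p₀ < numBits φ - 1 := by
    have h1 : N ≤ 2 ^ numBits φ := ncard_solutions_le φ
    have h2 : (2 : ℝ) ^ (p₀ + 2) ≤ 2 ^ numBits φ := by
      rw [pow_add]
      have : (2 : ℝ) ^ p₀ * 39.36 ≤ 2 ^ p₀ * a := by gcongr
      have h3 : (0 : ℝ) < 2 ^ p₀ := by positivity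
      linarith
    have := (pow_le_pow_iff_right₀ (by norm_num : (1 : ℝ) < 2)).1 h2
    omega
  have h2p : (0 : ℝ) < 2 ^ p₀ := by positivity
  obtain ⟨t, ht⟩ : ∃ t, t = N / 2 ^ p₀ / a := ⟨_, rfl⟩
  have ht1 : 1 ≤ t := by rw [ht, le_div_iff₀ ha0, le_div_iff₀ h2p]; linarith
  have ht2 : t ≤ 2 := by rw [ht, div_le_iff₀ ha0, div_le_iff₀ h2p]; linarith
  exact ⟨κ, a, t, p₀, hε, hκ0, hκ1, hκinv, hεκ, ha, hH, ha39, hl, hu, ht1, ht2,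
    by rw [ht]; field_simp; rfl⟩

/-- The counts `y` of a cell with `p` constraints for which the estimate `2 ^ p * y` is not within
the factor `1 + ε` of the number of solutions. -/
def inaccurate (φ : DNF n m) (ε : ℝ) (p : ℕ) : Set ℝ :=
  {y | y * (2 : ℝ) ^ p ∈
    (Set.Icc ((solutions φ).ncard / (1 + ε)) ((1 + ε) * (solutions φ).ncard : ℝ))ᶜ}

/-- The expected contribution of the tests with `k` constraints to the failure probability. -/
noncomputable def coreError (φ : DNF n m) (ε H : ℝ) (p₀ k : ℕ) : ℝ≥0∞ :=
  expect (sampleBase (numBits φ) ⌊startIndex φ H⌋₊) fun B =>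
    stepError φ B H (fun p => prob (bsat φ B H p) (inaccurate φ ε p)) p₀ k

theorem coreError_of_lt {φ : DNF n m} {ε H : ℝ} {p₀ k : ℕ} (hk : k < p₀) :
    coreError φ ε H p₀ k ≤
      min (cellProb φ H k (Set.Iio H)) (cellProb φ H k (inaccurate φ ε k)) :=
  cellProb_stepError_low_le (fun B p => prob (bsat φ B H p) (inaccurate φ ε p))
    (fun _ _ => prob_le_one _ _) hk

theorem coreError_self (φ : DNF n m) (ε H : ℝ) (p₀ : ℕ) :
    coreError φ ε H p₀ p₀ =
      cellProb φ H p₀ (Set.Ici H) + cellProb φ H p₀ (inaccurate φ ε p₀) := by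
  simp only [coreError, stepError, lt_irrefl, if_false, if_true]
  rw [expect_add]
  rfl

theorem coreError_of_gt {φ : DNF n m} {ε H : ℝ} {p₀ k : ℕ} (hk : p₀ < k) :
    coreError φ ε H p₀ k = cellProb φ H k (Set.Ici H) := by
  simp only [coreError, stepError, if_neg hk.not_gt, if_neg hk.ne']
  rfl

namespace CriticalParams

variable {φ : DNF n m} {ε κ a H t : ℝ} {p₀ : ℕ}

omit [NeZero m] in
theorem meanCount_eq (P : CriticalParams φ ε κ a H t p₀) (k : ℕ) :
    meanCount φ k = (t * (2 ^ p₀ / 2 ^ k)) * a := by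
  obtain ⟨hε, hκ0, hκ1, hκinv, hεκ, ha, hH, ha39, hl, hu, ht1, ht2, hN⟩ := id P
  rw [meanCount, hN]
  ring

omit [NeZero m] in
theorem meanCount_of_add (P : CriticalParams φ ε κ a H t p₀)  :
    ∀ j k, k + j = p₀ → meanCount φ k = (2 ^ j * t) * a := by
  obtain ⟨hε, hκ0, hκ1, hκinv, hεκ, ha, hH, ha39, hl, hu, ht1, ht2, hN⟩ := id P
  rintro j k rfl
  rw [P.meanCount_eq, pow_add]
  field_simp

omit [NeZero m] in
theorem meanCount_self (P : CriticalParams φ ε κ a H t p₀)  :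
    meanCount φ p₀ = t * a := by
  obtain ⟨hε, hκ0, hκ1, hκinv, hεκ, ha, hH, ha39, hl, hu, ht1, ht2, hN⟩ := id P
  simpa using P.meanCount_of_add 0 p₀ rfl

omit [NeZero m] in
theorem meanCount_pos (P : CriticalParams φ ε κ a H t p₀) (k : ℕ) :
    0 < meanCount φ k := by
  obtain ⟨hε, hκ0, hκ1, hκinv, hεκ, ha, hH, ha39, hl, hu, ht1, ht2, hN⟩ := id P
  rw [P.meanCount_eq]
  positivity

omit [NeZero m] in
theorem mem_inaccurate_iff (P : CriticalParams φ ε κ a H t p₀) (p : ℕ) (y : ℝ) :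
    y ∈ inaccurate φ ε p ↔
      y < meanCount φ p - κ * meanCount φ p ∨ (1 + ε) * meanCount φ p < y := by
  obtain ⟨hε, hκ0, hκ1, hκinv, hεκ, ha, hH, ha39, hl, hu, ht1, ht2, hN⟩ := id P
  exact mem_compl_Icc_iff hκinv p

omit [NeZero m] in
theorem meanCount_self_lt (P : CriticalParams φ ε κ a H t p₀)  :
    meanCount φ p₀ < H := by
  obtain ⟨hε, hκ0, hκ1, hκinv, hεκ, ha, hH, ha39, hl, hu, ht1, ht2, hN⟩ := id P
  rw [P.meanCount_self]
  nlinarith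

/-- Failure at `k < p₀` needs both a small test and an inaccurate final count, so the less likely
event suffices. Whichever is chosen, only deviations below `(1 - κ)μ` remain, and the one-sided
bound applies. -/
theorem coreError_le_cantelli (P : CriticalParams φ ε κ a H t p₀) (j k : ℕ) (hsk : ⌊startIndex φ H⌋₊ ≤ k)
    (hk : k + (j + 1) = p₀) :
    coreError φ ε H p₀ k ≤ ENNReal.ofReal (1 / (1 + 4.92 * (2 ^ (j + 1) * t))) := by
  obtain ⟨hε, hκ0, hκ1, hκinv, hεκ, ha, hH, ha39, hl, hu, ht1, ht2, hN⟩ := id P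
  have hκa : κ ^ 2 * a = 9.84 := by rw [ha]; field_simp
  have hH0 : 0 < H := by rw [hH]; positivity
  have hμ0 := P.meanCount_pos k
  have hval : 2 * meanCount φ k / (2 * meanCount φ k + (κ * meanCount φ k) ^ 2) =
      1 / (1 + 4.92 * (2 ^ (j + 1) * t)) := by
    have h1 : (κ * meanCount φ k) ^ 2 = 9.84 * (2 ^ (j + 1) * t) * meanCount φ k := by
      rw [← hκa]
      nth_rewrite 2 [P.meanCount_of_add (j + 1) k hk]
      nth_rewrite 1 [sq, P.meanCount_of_add (j + 1) k hk]
      rw [P.meanCount_of_add (j + 1) k hk]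
      ring
    rw [h1]
    have h2 : 0 < 1 + 4.92 * (2 ^ (j + 1) * t) := by positivity
    rw [div_eq_div_iff (by positivity) h2.ne']
    ring
  -- A count cut off at `H` can then never be an overestimate.
  have hHμ : H ≤ (1 + ε) * meanCount φ k := by
    have h1 : 2 * a ≤ meanCount φ k := by
      rw [P.meanCount_of_add (j + 1) k hk]
      have : (1 : ℝ) ≤ 2 ^ j := one_le_pow₀ (by norm_num)
      have : 2 ≤ 2 ^ (j + 1) * t := by rw [pow_succ]; nlinarith
      gcongr
    have h2 : (1 + ε) * (2 * a) ≤ (1 + ε) * meanCount φ k := by gcongr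
    have h3 : 1 ≤ (ε - κ) * a := by
      have hκε : κ ≤ ε := by nlinarith
      rw [hεκ]
      calc (1 : ℝ) ≤ 9.84 := by norm_num
        _ = κ * κ * a := by rw [← hκa]; ring
        _ ≤ ε * κ * a := by gcongr
    rw [hH]
    linarith
  rw [← hval]
  refine (coreError_of_lt (by omega)).trans ?_
  -- If `H ≤ (1 - κ)μ`, a small test is itself a large deviation. Otherwise the value `H` is
  -- accurate, and an inaccurate count must lie below `(1 - κ)μ`.
  rcases le_or_gt H (meanCount φ k - κ * meanCount φ k) with hc | hc
  · refine (min_le_left _ _).trans (cellProb_le_cantelli hsk (by omega) _ _ (by positivity)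
      hμ0 hH0 ?_ ?_)
    · intro y _ _ hy
      exact Or.inl (by linarith)
    · intro h
      exact absurd h (lt_irrefl H)
  · refine (min_le_right _ _).trans (cellProb_le_cantelli hsk (by omega) _ _ (by positivity)
      hμ0 hH0 ?_ ?_)
    · intro y hy _ hyH
      rcases (P.mem_inaccurate_iff k y).1 hy with h | h
      · exact Or.inl h
      · linarith
    · intro h
      rcases (P.mem_inaccurate_iff k H).1 h with h | h <;> linarith

theorem coreError_le_chebyshev (P : CriticalParams φ ε κ a H t p₀) {A h : ℝ} (hA : 0 < A) (hAa : A ≤ a)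
    (hHh : H ≤ h * a) (hh : 0 < h) (j k : ℕ) (hsk : ⌊startIndex φ H⌋₊ ≤ k) (hk : k + j = p₀)
    (hj : 0 < j) (hx : h < 2 ^ j * t) :
    coreError φ ε H p₀ k ≤
      ENNReal.ofReal (2 * (2 ^ j * t) / (A * (2 ^ j * t - h) ^ 2)) := by
  obtain ⟨hε, hκ0, hκ1, hκinv, hεκ, ha, hH, ha39, hl, hu, ht1, ht2, hN⟩ := id P
  have hH0 : 0 < H := by rw [hH]; positivity
  refine (coreError_of_lt (by omega)).trans ((min_le_left _ _).trans ?_)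
  have hlt : H < meanCount φ k := by
    rw [P.meanCount_of_add j k hk]
    exact hHh.trans_lt (by gcongr)
  refine (cellProb_Iio_le hsk (by omega) hH0 hlt).trans (ENNReal.ofReal_le_ofReal ?_)
  rw [P.meanCount_of_add j k hk]
  exact low_term_le hA hAa hHh hh hx

theorem coreError_le_dyadic (P : CriticalParams φ ε κ a H t p₀) {A h r : ℝ} (hA : 0 < A) (hAa : A ≤ a)
    (hHh : H ≤ h * a) (hh : 0 < h) (hr : 0 < r) (hhr : h ≤ (1 - r) * 16) (hr1 : r < 1) (k : ℕ)
    (hsk : ⌊startIndex φ H⌋₊ ≤ k) (hk : k + 4 ≤ p₀) :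
    coreError φ ε H p₀ k ≤
      ENNReal.ofReal (2 / (A * r ^ 2) / t * (2 ^ k / 2 ^ p₀)) := by
  obtain ⟨hε, hκ0, hκ1, hκinv, hεκ, ha, hH, ha39, hl, hu, ht1, ht2, hN⟩ := id P
  obtain ⟨j, hj⟩ : ∃ j, k + (j + 4) = p₀ := ⟨p₀ - k - 4, by omega⟩
  have hx : 16 ≤ 2 ^ (j + 4) * t := by
    have : (1 : ℝ) ≤ 2 ^ j := one_le_pow₀ (by norm_num)
    rw [pow_add]
    nlinarith
  have hle : h ≤ (1 - r) * (2 ^ (j + 4) * t) := hhr.trans (by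
    have : 0 < 1 - r := by linarith
    gcongr)
  refine (P.coreError_le_chebyshev hA hAa hHh hh (j + 4) k hsk hj (by omega) (by nlinarith)).trans
    (ENNReal.ofReal_le_ofReal ?_)
  refine (low_term_le_inv hA hr hle (by positivity)).trans (le_of_eq ?_)
  rw [← hj, pow_add 2 k]
  field_simp

theorem coreError_le_of_gt (P : CriticalParams φ ε κ a H t p₀) {K : ℝ} (hK : κ ≤ K) (k : ℕ) (hk : p₀ < k)
    (hkq : k < numBits φ - 1) :
    coreError φ ε H p₀ k ≤
      ENNReal.ofReal (K ^ 2 / 4.92 * t / (2 + 2 * K - t / 2) ^ 2 * (2 ^ p₀ / 2 ^ k)) := by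
  obtain ⟨hε, hκ0, hκ1, hκinv, hεκ, ha, hH, ha39, hl, hu, ht1, ht2, hN⟩ := id P
  have hκap : 0 < κ * a := by positivity
  have hH0 : 0 < H := by rw [hH]; positivity
  rw [coreError_of_gt hk]
  have hx : t * (2 ^ p₀ / 2 ^ k) ≤ t / 2 := by
    have : (2 : ℝ) ^ p₀ / 2 ^ k ≤ 1 / 2 := by
      rw [div_le_div_iff₀ (by positivity) (by norm_num), one_mul, ← pow_succ]
      exact pow_le_pow_right₀ (by norm_num) hk
    calc _ ≤ t * (1 / 2) := by gcongr
      _ = _ := by ring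
  have hxp : 0 < t * ((2 : ℝ) ^ p₀ / 2 ^ k) := by positivity
  have hlt : meanCount φ k < H := by
    rw [P.meanCount_eq]
    have : t * (2 ^ p₀ / 2 ^ k) * a ≤ 1 * a := by gcongr; linarith
    linarith
  refine (cellProb_Ici_le (by omega) (by omega) hH0 hlt).trans (ENNReal.ofReal_le_ofReal ?_)
  rw [P.meanCount_eq]
  refine (high_term_le hκ0 hK hxp (by linarith) ha (by rw [hH]; linarith)).trans ?_
  refine (high_term_tail_le (by linarith) hxp hx ht2).trans (le_of_eq ?_)
  ring

theorem cellProb_Ici_le_self (P : CriticalParams φ ε κ a H t p₀) {K : ℝ} (hK : κ ≤ K) :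
    cellProb φ H p₀ (Set.Ici H) ≤
      ENNReal.ofReal (K ^ 2 / 4.92 * t / (2 + 2 * K - t) ^ 2) := by
  obtain ⟨hε, hκ0, hκ1, hκinv, hεκ, ha, hH, ha39, hl, hu, ht1, ht2, hN⟩ := id P
  have hH0 : 0 < H := by rw [hH]; positivity
  refine (cellProb_Ici_le (by omega) (by omega) hH0 P.meanCount_self_lt).trans
    (ENNReal.ofReal_le_ofReal ?_)
  rw [P.meanCount_self]
  exact high_term_le hκ0 hK (by linarith) ht2 ha (by rw [hH]; linarith)

/-- For `κ ≥ 0.29` the upper tolerance `ε` exceeds `κ` by enough that overestimates lie beyond `μ +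
α + 4μ/α` with `α = κμ`; Cantelli's bound then covers both sides. -/
theorem cellProb_inaccurate_le_of_large (P : CriticalParams φ ε κ a H t p₀) (hcase : 0.29 ≤ κ) :
    cellProb φ H p₀ (inaccurate φ ε p₀) ≤
      ENNReal.ofReal (1 / (1 + 4.92 * t)) := by
  obtain ⟨hε, hκ0, hκ1, hκinv, hεκ, ha, hH, ha39, hl, hu, ht1, ht2, hN⟩ := id P
  have hκa : κ ^ 2 * a = 9.84 := by rw [ha]; field_simp
  have hH0 : 0 < H := by rw [hH]; positivity
  have hlt0 := P.meanCount_self_lt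
  have hμ0 := P.meanCount_pos p₀
  have hval : 2 * meanCount φ p₀ / (2 * meanCount φ p₀ + (κ * meanCount φ p₀) ^ 2) =
      1 / (1 + 4.92 * t) := by
    rw [P.meanCount_self]
    have h1 : (κ * (t * a)) ^ 2 = 9.84 * t * (t * a) := by rw [← hκa]; ring
    rw [h1]
    have h2 : 0 < 1 + 4.92 * t := by positivity
    rw [div_eq_div_iff (by positivity) h2.ne']
    ring
  have hup : meanCount φ p₀ + κ * meanCount φ p₀ +
      4 * meanCount φ p₀ / (κ * meanCount φ p₀) ≤ (1 + ε) * meanCount φ p₀ := by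
    have h1 : 4 * meanCount φ p₀ / (κ * meanCount φ p₀) = 4 / κ := by field_simp
    have hε4 : 0.407 ≤ ε := by nlinarith
    have h2 : 4 / κ ≤ (ε - κ) * meanCount φ p₀ := by
      rw [div_le_iff₀ hκ0, hεκ, P.meanCount_self]
      calc (4 : ℝ) ≤ 0.407 * (9.84 * 1) := by norm_num
        _ ≤ ε * (κ ^ 2 * a * t) := by rw [hκa]; gcongr
        _ = _ := by ring
    rw [h1]
    linarith
  rw [← hval]
  refine cellProb_le_cantelli (by omega) (by omega) _ _ (by positivity) hμ0 hH0 ?_ ?_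
  · intro y hy _ _
    rcases (P.mem_inaccurate_iff p₀ y).1 hy with h | h
    · exact Or.inl h
    · exact Or.inr (by linarith)
  · intro h
    have : 0 < κ * meanCount φ p₀ := by positivity
    rcases (P.mem_inaccurate_iff p₀ H).1 h with h | h <;> linarith

theorem cellProb_inaccurate_le_of_small (P : CriticalParams φ ε κ a H t p₀)  :
    cellProb φ H p₀ (inaccurate φ ε p₀) ≤
      ENNReal.ofReal (1 / (4.92 * t)) := by
  obtain ⟨hε, hκ0, hκ1, hκinv, hεκ, ha, hH, ha39, hl, hu, ht1, ht2, hN⟩ := id P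
  have hκa : κ ^ 2 * a = 9.84 := by rw [ha]; field_simp
  have hH0 : 0 < H := by rw [hH]; positivity
  have hlt0 := P.meanCount_self_lt
  have hμ0 := P.meanCount_pos p₀
  have hκε : κ ≤ ε := by nlinarith
  have hle : κ * meanCount φ p₀ ≤ ε * meanCount φ p₀ := by gcongr
  have hpos : 0 < κ * meanCount φ p₀ := by positivity
  have hval : 2 * meanCount φ p₀ / (κ * meanCount φ p₀) ^ 2 = 1 / (4.92 * t) := by
    rw [P.meanCount_self]
    have h1 : (κ * (t * a)) ^ 2 = 9.84 * t * (t * a) := by rw [← hκa]; ring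
    rw [h1, div_eq_div_iff (by positivity) (by positivity)]
    ring
  rw [← hval]
  refine cellProb_le_chebyshev (by omega) (by omega) _ _ hpos hH0 ?_ ?_
  · intro y hy _ _
    rcases (P.mem_inaccurate_iff p₀ y).1 hy with h | h
    · rw [abs_of_neg (by linarith)]
      linarith
    · rw [abs_of_nonneg (by linarith)]
      linarith
  · intro h
    rcases (P.mem_inaccurate_iff p₀ H).1 h with h | h <;> linarith

theorem ite_zero_le {p : Prop} [Decidable p] (x b : ℝ≥0∞) (h : p → x ≤ b) :
    (if p then x else 0) ≤ b := by
  split_ifs with hp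
  · exact h hp
  · exact zero_le

/-- Here `a ≥ 9.84 / 0.5² = 39.36`, `H/a ≤ 3 + 2/39.36 < 3.051`, and `r = 0.809` satisfies `3.051 ≤
16 (1 - r)`. Cantelli's bound serves at distances 1 and 2 below `p₀`, Chebyshev's from 3 on. -/
theorem sum_coreError_le_of_large (P : CriticalParams φ ε κ a H t p₀) (hcase : 0.29 ≤ κ) :
    ∑ k ∈ Finset.range (numBits φ - 1),
      (if ⌊startIndex φ H⌋₊ ≤ k then coreError φ ε H p₀ k else 0) ≤ ENNReal.ofReal 0.36 := by
  obtain ⟨hε, hκ0, hκ1, hκinv, hεκ, ha, hH, ha39, hl, hu, ht1, ht2, hN⟩ := id P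
  have hHh : H ≤ 3.051 * a := by rw [hH]; nlinarith
  refine (sum_range_le_of_dyadic _ p₀ _ hu (2 / (39.36 * 0.809 ^ 2) / t)
    (2 * (8 * t) / (39.36 * (8 * t - 3.051) ^ 2)) (1 / (1 + 19.68 * t)) (1 / (1 + 9.84 * t))
    (0.5 ^ 2 / 4.92 * t / (2 + 2 * 0.5 - t) ^ 2 + 1 / (1 + 4.92 * t))
    (0.5 ^ 2 / 4.92 * t / (2 + 2 * 0.5 - t / 2) ^ 2) (by positivity) (by positivity)
    (by positivity) (by positivity) (by positivity) (by positivity)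
    ?_ ?_ ?_ ?_ ?_ ?_).trans (ENNReal.ofReal_le_ofReal (total_error_le_of_large ht1 ht2))
  · exact fun k hk => ite_zero_le _ _ fun hsk => P.coreError_le_dyadic (A := 39.36) (h := 3.051) (r := 0.809) (by norm_num) ha39 hHh
      (by norm_num) (by norm_num) (by norm_num) (by norm_num) k hsk hk
  · intro k hk
    refine ite_zero_le _ _ fun hsk => ?_
    have := P.coreError_le_chebyshev (A := 39.36) (h := 3.051) (by norm_num) ha39 hHh (by norm_num) 3 k hsk hk (by norm_num)
      (by norm_num; linarith)
    rwa [show (2 : ℝ) ^ 3 = 8 by norm_num] at this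
  · intro k hk
    refine ite_zero_le _ _ fun hsk => (P.coreError_le_cantelli 1 k hsk hk).trans (le_of_eq ?_)
    norm_num
    ring_nf
  · intro k hk
    refine ite_zero_le _ _ fun hsk => (P.coreError_le_cantelli 0 k hsk hk).trans (le_of_eq ?_)
    norm_num
    ring_nf
  · refine ite_zero_le _ _ fun _ => ?_
    rw [coreError_self, ENNReal.ofReal_add (by positivity) (by positivity)]
    exact add_le_add (P.cellProb_Ici_le_self hκ1) (P.cellProb_inaccurate_le_of_large hcase)
  · exact fun k hk hkq => ite_zero_le _ _ fun _ => P.coreError_le_of_gt (K := 0.5) hκ1 k hk hkq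

/-- Now `a ≥ 117` and `H/a ≤ 2.58 + 2/117 < 2.598`. The smaller errors at distance 2 and beyond pay
for the weaker two-sided Chebyshev bound at `p₀`. -/
theorem sum_coreError_le_of_small (P : CriticalParams φ ε κ a H t p₀) (hcase : κ ≤ 0.29) :
    ∑ k ∈ Finset.range (numBits φ - 1),
      (if ⌊startIndex φ H⌋₊ ≤ k then coreError φ ε H p₀ k else 0) ≤ ENNReal.ofReal 0.36 := by
  obtain ⟨hε, hκ0, hκ1, hκinv, hεκ, ha, hH, ha39, hl, hu, ht1, ht2, hN⟩ := id P
  have ha117 : 117 ≤ a := by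
    rw [ha, le_div_iff₀ (by positivity)]
    nlinarith
  have hHh : H ≤ 2.598 * a := by rw [hH]; nlinarith
  refine (sum_range_le_of_dyadic _ p₀ _ hu (2 / (117 * 0.837 ^ 2) / t)
    (2 * (8 * t) / (117 * (8 * t - 2.598) ^ 2)) (2 * (4 * t) / (117 * (4 * t - 2.598) ^ 2))
    (1 / (1 + 9.84 * t)) (0.29 ^ 2 / 4.92 * t / (2 + 2 * 0.29 - t) ^ 2 + 1 / (4.92 * t))
    (0.29 ^ 2 / 4.92 * t / (2 + 2 * 0.29 - t / 2) ^ 2) (by positivity) (by positivity)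
    (by positivity) (by positivity) (by positivity) (by positivity)
    ?_ ?_ ?_ ?_ ?_ ?_).trans (ENNReal.ofReal_le_ofReal (total_error_le_of_small ht1 ht2))
  · exact fun k hk => ite_zero_le _ _ fun hsk => P.coreError_le_dyadic (A := 117) (h := 2.598) (r := 0.837) (by norm_num) ha117 hHh
      (by norm_num) (by norm_num) (by norm_num) (by norm_num) k hsk hk
  · intro k hk
    refine ite_zero_le _ _ fun hsk => ?_
    have := P.coreError_le_chebyshev (A := 117) (h := 2.598) (by norm_num) ha117 hHh (by norm_num) 3 k hsk hk (by norm_num)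
      (by norm_num; linarith)
    rwa [show (2 : ℝ) ^ 3 = 8 by norm_num] at this
  · intro k hk
    refine ite_zero_le _ _ fun hsk => ?_
    have := P.coreError_le_chebyshev (A := 117) (h := 2.598) (by norm_num) ha117 hHh (by norm_num) 2 k hsk hk (by norm_num)
      (by norm_num; linarith)
    rwa [show (2 : ℝ) ^ 2 = 4 by norm_num] at this
  · intro k hk
    refine ite_zero_le _ _ fun hsk => (P.coreError_le_cantelli 0 k hsk hk).trans (le_of_eq ?_)
    norm_num
    ring_nf
  · refine ite_zero_le _ _ fun _ => ?_
    rw [coreError_self, ENNReal.ofReal_add (by positivity) (by positivity)]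
    exact add_le_add (P.cellProb_Ici_le_self hcase) P.cellProb_inaccurate_le_of_small
  · exact fun k hk hkq => ite_zero_le _ _ fun _ => P.coreError_le_of_gt hcase k hk hkq


end CriticalParams

theorem prob_core_le_of_hiThresh (φ : DNF n m) (ε : ℝ) (hε : 0 < ε) (hε1 : ε < 1)
    (hstart : 0 ≤ startIndex φ (hiThresh ε)) :
    prob (symbolicDNFApproxMCCore φ (hiThresh ε)) {r | r.2 * r.1 ∈
      (Set.Icc ((solutions φ).ncard / (1 + ε)) ((1 + ε) * (solutions φ).ncard : ℝ))ᶜ}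
      ≤ ENNReal.ofReal 0.36 := by
  obtain ⟨κ, a, t, p₀, P⟩ := exists_criticalParams φ ε hε hε1 hstart
  refine (prob_core_le φ _ _ p₀ P.start_lt P.lt_numBits).trans ?_
  change ∑ k ∈ Finset.Ico _ _, coreError φ ε (hiThresh ε) p₀ k ≤ _
  -- Numbers below the start index are padded with zero error, so that the dyadic sum can start at
  -- `0`.
  have hsum : ∑ k ∈ Finset.Ico ⌊startIndex φ (hiThresh ε)⌋₊ (numBits φ - 1),
      coreError φ ε (hiThresh ε) p₀ k = ∑ k ∈ Finset.range (numBits φ - 1),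
        if ⌊startIndex φ (hiThresh ε)⌋₊ ≤ k then coreError φ ε (hiThresh ε) p₀ k else 0 := by
    rw [← Finset.sum_filter]
    congr 1
    ext k
    simp only [Finset.mem_Ico, Finset.mem_filter, Finset.mem_range]
    omega
  rw [hsum]
  rcases le_total 0.29 κ with h | h
  · exact P.sum_coreError_le_of_large h
  · exact P.sum_coreError_le_of_small h

end SymbolicDNF

theorem mainTheorem1 (n m : ℕ) [NeZero m] (φ : SymbolicDNF.DNF n m) (ε δ : ℝ)
    (hε : 0 < ε) (hε1 : ε < 1) (hδ : 0 < δ) (hδ1 : δ < 1)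
    (hstart : 0 ≤ SymbolicDNF.startIndex φ (SymbolicDNF.hiThresh ε)) :
    1 - δ ≤ ((SymbolicDNF.symbolicDNFApproxMC φ ε δ).toMeasure
      {c : ℝ | ((SymbolicDNF.solutions φ).ncard : ℝ) / (1 + ε) ≤ c ∧
        c ≤ (1 + ε) * ((SymbolicDNF.solutions φ).ncard : ℝ)}).toReal :=
  SymbolicDNF.approxMC_of_core φ ε δ _ _ hδ hδ1
    (SymbolicDNF.prob_core_le_of_hiThresh φ ε hε hε1 hstart)
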